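/- Let $n,m\ge 0$ and let $E$ be a smooth (Hausdorff, second countable) manifold of dimension $n+m$. Submanifolds of $E$ are embedded and smooth. For $r\ge 1$ let $J^r(E,n)$ be the space of $r$-jets $[L]^r_p$ of $n$-dimensional submanifolds $L$ of $E$ at points $p\in L$: two submanifolds through $p$ have the same $r$-jet at $p$ if, in a chart $(u^\lambda,u^i)$ ($1\le\lambda\le n<i\le n+m$) in which they are the graphs $u^i=f^i(u^1,\dots,u^n)$ and $u^i=f'^i(u^1,\dots,u^n)$ near $p$, the Taylor expansions of $f$ and $f'$ at $p$ agree up to order $r$. Identify $[L]^1_p$ with $T_pL$, so that $\pi_{1,0}\colon J^1(E,n)\to E$ is the Grassmann bundle of $n$-planes in $TE$, and let $\pi_{2,1}\colon J^2(E,n)\to J^1(E,n)$, $[L]^2_p\mapsto[L]^1_p$. Let $H\subset T=\pi_{1,0}^*TE$ be the tautological subbundle over $J^1(E,n)$ (with fibre $\theta$ at $\theta\in J^1(E,n)$), $V=T/H$, and $\omega\colon T\to V$ the projection. For $\theta_2=[L]^2_p$ over $\theta_1=[L]^1_p$, let $R_{\theta_2}\subset T_{\theta_1}J^1(E,n)$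 be the tangent space at $\theta_1$ of $L^{(1)}=\{[L]^1_q : q\in L\}$; it projects isomorphically onto $\theta_1=T_pL$. Let $\Gamma$ be a smooth torsion-free linear connection on $TE\to E$, with covariant derivative $\nabla$. * The equation of $n$-dimensional totally geodesic submanifolds of $\Gamma$ is the set $\mathcal S_\Gamma\subset J^2(E,n)$ of all $[L]^2_p$ such that the second fundamental form of $L$ at $p$ vanishes, i.e. $\nabla_XY\in T_pL$ for all $X\in T_pL$ and all smooth vector fields $Y$ near $p$ tangent to $L$ along $L$. Two such connections $\Gamma,\Gamma'$ are $n$-Grassmannian equivalent if $\mathcal S_\Gamma=\mathcal S_{\Gamma'}$. * The connection $\dot\Gamma$ on $\pi_{1,0}$ induced by $\Gamma$ has the vertical projection $\upsilon_{\dot\Gamma}\colon TJ^1(E,n)\to H^*\otimes V$ given by $\upsilon_{\dot\Gamma}(v)(Y(\theta))=\omega\big(\nabla[\pi_{1,0}^*\Gamma]_vY\big)$ for $v\in T_\theta J^1(E,n)$ and every section $Y$ of $H\subset T$ that is smooth at $\theta$. A $\dot\Gamma$-horizontal lift of $w\in T_pE$ to $\theta\in\pi_{1,0}^{-1}(p)$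 is a vector $v\in T_\theta J^1(E,n)$ that projects to $w$ and satisfies $\upsilon_{\dot\Gamma}(v)=0$. * The $n$-Grassmannian structure of $\Gamma$ is the section $\ddot\Gamma\colon J^1(E,n)\to J^2(E,n)$ of $\pi_{2,1}$ such that, for every $\theta\in J^1(E,n)$ and $w\in\theta$, the vector of $R_{\ddot\Gamma(\theta)}$ that projects to $w$ is the $\dot\Gamma$-horizontal lift of $w$ to $\theta$. **Theorem.** Let $\Gamma$ and $\Gamma'$ be two smooth torsion-free linear connections on $TE\to E$. Then the sections $\ddot\Gamma$ and $\ddot\Gamma'$ exist and are unique, and $\Gamma$ and $\Gamma'$ are $n$-Grassmannian equivalent if and only if $\ddot\Gamma=\ddot\Gamma'$. -/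

import Mathlib

open Set Filter Topology Bundle
open scoped Manifold ContDiff

namespace SubmanifoldJet
noncomputable section

/-- The model space `ℝⁿ × ℝᵐ` of an `(n+m)`-dimensional manifold. A chart with values in it is a
divided chart `(u^λ, u^i)`, with `λ = 1, …, n` and `i = n+1, …, n+m`. -/
abbrev Model (n m : ℕ) : Type := EuclideanSpace ℝ (Fin n) × EuclideanSpace ℝ (Fin m)

/-- The tangent space `T_p S` of a submanifold `S` at `p`: the span of the velocities at time `0`
of the smooth curves through `p` that stay in `S`. -/
def tangentPlane (F : Type*) {M : Type*} [NormedAddCommGroup F] [NormedSpace ℝ F] [TopologicalSpace M]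
    [ChartedSpace F M] (S : Set M) (p : M) : Submodule ℝ (TangentSpace 𝓘(ℝ, F) p) :=
  Submodule.span ℝ {v | ∃ γ : ℝ → M, ContMDiffAt 𝓘(ℝ, ℝ) 𝓘(ℝ, F) ∞ γ 0 ∧ γ 0 = p ∧
    (∀ᶠ t in 𝓝 (0 : ℝ), γ t ∈ S) ∧ mfderiv 𝓘(ℝ, ℝ) 𝓘(ℝ, F) γ 0 (1 : ℝ) = v}

section Submanifolds

variable {n m : ℕ} {E : Type*} [TopologicalSpace E] [ChartedSpace (Model n m) E]

/-- Near `p`, the set `L` is described in the divided chart `φ` (which is concordant to `L` at `p`)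
by `u^i = f^i(u^1, …, u^n)` with `f` smooth. -/
structure IsLocalGraph (L : Set E) (p : E) (φ : OpenPartialHomeomorph E (Model n m))
    (f : EuclideanSpace ℝ (Fin n) → EuclideanSpace ℝ (Fin m)) : Prop where
  mem_maximalAtlas : φ ∈ IsManifold.maximalAtlas 𝓘(ℝ, Model n m) ∞ E
  mem_source : p ∈ φ.source
  contDiffAt : ∀ᶠ x in 𝓝 (φ p).1, ContDiffAt ℝ ∞ f x
  mem_iff : ∀ᶠ q in 𝓝 p, (q ∈ L ↔ (φ q).2 = f (φ q).1)

variable (n m E) in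
/-- An `n`-dimensional embedded submanifold `L` of `E`, with a point of `L`. -/
structure PointedSubmanifold where
  carrier : Set E
  exists_graph : ∀ p ∈ carrier, ∃ (φ : OpenPartialHomeomorph E (Model n m))
    (f : EuclideanSpace ℝ (Fin n) → EuclideanSpace ℝ (Fin m)), IsLocalGraph carrier p φ f
  pt : E
  pt_mem : pt ∈ carrier

/-- `L` and `L'` have a contact of order `r` at their common base point: in a divided chart
concordant to both of them the Taylor expansions of `f` and `f'` agree up to order `r`. -/
def HasContact (r : ℕ) (P Q : PointedSubmanifold n m E) : Prop :=
  P.pt = Q.pt ∧ ∃ (φ : OpenPartialHomeomorph E (Model n m))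
    (f g : EuclideanSpace ℝ (Fin n) → EuclideanSpace ℝ (Fin m)),
    IsLocalGraph P.carrier P.pt φ f ∧ IsLocalGraph Q.carrier Q.pt φ g ∧
    ∀ k ≤ r, iteratedFDeriv ℝ k f (φ P.pt).1 = iteratedFDeriv ℝ k g (φ P.pt).1

variable (n m E) in
/-- The space `J^r(E,n)` of `r`-jets of `n`-dimensional submanifolds. -/
def Jet (r : ℕ) : Type _ := Quot (HasContact (n := n) (m := m) (E := E) r)

/-- The `r`-jet `[L]^r_p`. -/
def PointedSubmanifold.jet (r : ℕ) (P : PointedSubmanifold n m E) : Jet n m E r := Quot.mk _ P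

variable (n m E) in
/-- The space `J^1(E,n)`, identified with the Grassmann bundle of `n`-dimensional subspaces of the
tangent spaces of `E`. -/
structure GrassmannBundle where
  pt : E
  plane : Submodule ℝ (TangentSpace 𝓘(ℝ, Model n m) pt)
  finrank_plane : Module.finrank ℝ plane = n

end Submanifolds

section TangentGraph

variable {n m : ℕ} {E : Type*} [TopologicalSpace E] [ChartedSpace (Model n m) E]

/-- The differential of a divided chart. -/
abbrev dChart (φ : OpenPartialHomeomorph E (Model n m)) (p : E) :
    TangentSpace 𝓘(ℝ, Model n m) p →L[ℝ] Model n m :=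
  mfderiv 𝓘(ℝ, Model n m) 𝓘(ℝ, Model n m) φ p

/-- The differential of the inverse of a divided chart. -/
abbrev dChartSymm (φ : OpenPartialHomeomorph E (Model n m)) (z : Model n m) :
    Model n m →L[ℝ] TangentSpace 𝓘(ℝ, Model n m) (φ.symm z) :=
  mfderiv 𝓘(ℝ, Model n m) 𝓘(ℝ, Model n m) φ.symm z

theorem mdiff_of_mem {φ : OpenPartialHomeomorph E (Model n m)}
    (hφ : φ ∈ IsManifold.maximalAtlas 𝓘(ℝ, Model n m) ∞ E) {p : E} (hp : p ∈ φ.source) :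
    MDifferentiableAt 𝓘(ℝ, Model n m) 𝓘(ℝ, Model n m) φ p :=
  (contMDiffAt_of_mem_maximalAtlas hφ hp).mdifferentiableAt (by simp)

theorem mdiff_symm_of_mem {φ : OpenPartialHomeomorph E (Model n m)}
    (hφ : φ ∈ IsManifold.maximalAtlas 𝓘(ℝ, Model n m) ∞ E) {z : Model n m} (hz : z ∈ φ.target) :
    MDifferentiableAt 𝓘(ℝ, Model n m) 𝓘(ℝ, Model n m) φ.symm z :=
  (contMDiffAt_symm_of_mem_maximalAtlas hφ hz).mdifferentiableAt (by simp)

theorem dChart_dChartSymm {φ : OpenPartialHomeomorph E (Model n m)}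
    (hφ : φ ∈ IsManifold.maximalAtlas 𝓘(ℝ, Model n m) ∞ E) {z : Model n m} (hz : z ∈ φ.target)
    (v : Model n m) : dChart φ (φ.symm z) (dChartSymm φ z v) = v := by
  have h1 := (mdiff_of_mem hφ (φ.map_target hz)).hasMFDerivAt.comp z
    (mdiff_symm_of_mem hφ hz).hasMFDerivAt
  have h2 : HasMFDerivAt 𝓘(ℝ, Model n m) 𝓘(ℝ, Model n m) (φ ∘ φ.symm) z
      (ContinuousLinearMap.id ℝ _) := by
    refine (hasMFDerivAt_id z).congr_of_eventuallyEq ?_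
    filter_upwards [φ.open_target.mem_nhds hz] with y hy using φ.right_inv hy
  exact congrArg (fun T => T v) (hasMFDerivAt_unique h1 h2)

theorem dChartSymm_dChart {φ : OpenPartialHomeomorph E (Model n m)}
    (hφ : φ ∈ IsManifold.maximalAtlas 𝓘(ℝ, Model n m) ∞ E) {p : E} (hp : p ∈ φ.source)
    (v : TangentSpace 𝓘(ℝ, Model n m) p) : dChartSymm φ (φ p) (dChart φ p v) = v := by
  have h1 := (mdiff_symm_of_mem hφ (φ.map_source hp)).hasMFDerivAt.comp p
    (mdiff_of_mem hφ hp).hasMFDerivAt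
  have h2 : HasMFDerivAt 𝓘(ℝ, Model n m) 𝓘(ℝ, Model n m) (φ.symm ∘ φ) p
      (ContinuousLinearMap.id ℝ _) := by
    refine (hasMFDerivAt_id p).congr_of_eventuallyEq ?_
    filter_upwards [φ.open_source.mem_nhds hp] with y hy using φ.left_inv hy
  exact congrArg (fun T => T v) (hasMFDerivAt_unique h1 h2)

theorem dChart_injective {φ : OpenPartialHomeomorph E (Model n m)}
    (hφ : φ ∈ IsManifold.maximalAtlas 𝓘(ℝ, Model n m) ∞ E) {p : E} (hp : p ∈ φ.source) :
    Function.Injective (dChart φ p) := fun v w h => by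
  rw [← dChartSymm_dChart hφ hp v, h, dChartSymm_dChart hφ hp w]

/-- In a divided chart, the tangent space of the graph of `f` is the graph of the differential. -/
theorem map_tangentPlane {L : Set E} {p : E} (hp : p ∈ L)
    {φ : OpenPartialHomeomorph E (Model n m)}
    {f : EuclideanSpace ℝ (Fin n) → EuclideanSpace ℝ (Fin m)} (h : IsLocalGraph L p φ f) :
    (tangentPlane (Model n m) L p).map (dChart φ p).toLinearMap = (fderiv ℝ f (φ p).1).toLinearMap.graph := by
  have hφ := h.mem_maximalAtlas
  have hps := h.mem_source
  have hf : DifferentiableAt ℝ f (φ p).1 := h.contDiffAt.self_of_nhds.differentiableAt (by simp)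
  have hpt : (φ p).2 = f (φ p).1 := h.mem_iff.self_of_nhds.1 hp
  apply le_antisymm
  · rw [tangentPlane, Submodule.map_span_le]
    rintro _ ⟨γ, hγ, rfl, hL, rfl⟩
    have h1 : HasFDerivAt (φ ∘ γ) ((dChart φ (γ 0)).comp (mfderiv 𝓘(ℝ, ℝ) 𝓘(ℝ, Model n m) γ 0))
        (0 : ℝ) := hasMFDerivAt_iff_hasFDerivAt.1 ((mdiff_of_mem hφ hps).hasMFDerivAt.comp (0 : ℝ)
      (hγ.mdifferentiableAt (by simp)).hasMFDerivAt)
    have h2 := h1.fst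
    have h3 := h1.snd
    have h4 := hf.hasFDerivAt.comp (0 : ℝ) h2
    have h5 : HasFDerivAt (fun t => (φ (γ t)).2) _ (0 : ℝ) := h4.congr_of_eventuallyEq (by
      filter_upwards [hL, hγ.continuousAt.eventually h.mem_iff] with t ht ht2 using ht2.1 ht)
    exact congrArg (fun T => T 1) (h3.unique h5)
  · rintro ⟨a, b⟩ hab
    obtain rfl : b = fderiv ℝ f (φ p).1 a := hab
    refine ⟨dChartSymm φ (φ p) (a, fderiv ℝ f (φ p).1 a), ?_, ?_⟩
    · let c : ℝ → Model n m := fun t => ((φ p).1 + t • a, f ((φ p).1 + t • a))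
      have hc0 : c 0 = φ p := by simp [c, ← hpt]
      have hl : ContDiff ℝ ∞ (fun t : ℝ => (φ p).1 + t • a) := by fun_prop
      have hcs : ContDiffAt ℝ ∞ c 0 := by
        refine hl.contDiffAt.prodMk (ContDiffAt.comp (0 : ℝ) ?_ hl.contDiffAt)
        simpa using h.contDiffAt.self_of_nhds
      have hcd : HasFDerivAt c (ContinuousLinearMap.toSpanSingleton ℝ
          ((a, fderiv ℝ f (φ p).1 a) : Model n m)) (0 : ℝ) := by
        have e1 : HasDerivAt (fun t : ℝ => (φ p).1 + t • a) a 0 := by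
          simpa using ((hasDerivAt_id (0 : ℝ)).smul_const a).const_add (φ p).1
        have e2 : HasDerivAt (fun t : ℝ => f ((φ p).1 + t • a)) (fderiv ℝ f (φ p).1 a) 0 := by
          refine HasFDerivAt.comp_hasDerivAt (0 : ℝ) ?_ e1
          simpa using hf.hasFDerivAt
        exact (e1.prodMk e2).hasFDerivAt
      have hsm : ContMDiffAt 𝓘(ℝ, Model n m) 𝓘(ℝ, Model n m) ∞ φ.symm (c 0) :=
        hc0 ▸ contMDiffAt_symm_of_mem_maximalAtlas hφ (φ.map_source hps)
      have hγ : ContMDiffAt 𝓘(ℝ, ℝ) 𝓘(ℝ, Model n m) ∞ (φ.symm ∘ c) 0 :=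
        hsm.comp (0 : ℝ) hcs.contMDiffAt
      have hγ0 : (φ.symm ∘ c) 0 = p := by simp [hc0, φ.left_inv hps]
      have hd := (mdiff_symm_of_mem hφ (hc0.symm ▸ φ.map_source hps)).hasMFDerivAt.comp (0 : ℝ)
        hcd.hasMFDerivAt
      refine Submodule.subset_span ⟨φ.symm ∘ c, hγ, hγ0, ?_, ?_⟩
      · have hcon : Tendsto (φ.symm ∘ c) (𝓝 0) (𝓝 p) := by
          simpa [hc0, φ.left_inv hps] using hγ.continuousAt.tendsto
        have htar : ∀ᶠ t in 𝓝 (0 : ℝ), c t ∈ φ.target :=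
          hcs.continuousAt.eventually (hc0.symm ▸ φ.open_target.mem_nhds (φ.map_source hps))
        filter_upwards [hcon.eventually h.mem_iff, htar] with t ht ht2
        refine ht.2 ?_
        simp [φ.right_inv ht2, c]
      · rw [hd.mfderiv]
        change dChartSymm φ (c 0) ((1 : ℝ) • (a, fderiv ℝ f (φ p).1 a)) = _
        rw [hc0, one_smul]
    · have := dChart_dChartSymm hφ (φ.map_source hps) (a, fderiv ℝ f (φ p).1 a)
      rw [φ.left_inv hps] at this
      exact this

theorem finrank_tangentPlane (P : PointedSubmanifold n m E) :
    Module.finrank ℝ (tangentPlane (Model n m) P.carrier P.pt) = n := by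
  obtain ⟨φ, f, h⟩ := P.exists_graph P.pt P.pt_mem
  have h1 := LinearEquiv.finrank_eq (Submodule.equivMapOfInjective
    (dChart φ P.pt).toLinearMap (dChart_injective h.mem_maximalAtlas h.mem_source)
    (tangentPlane (Model n m) P.carrier P.pt))
  rw [h1, map_tangentPlane P.pt_mem h]
  rw [LinearMap.graph_eq_range_prod, LinearMap.finrank_range_of_inj, finrank_euclideanSpace_fin]
  intro x y hxy
  exact congrArg Prod.fst hxy

/-- The `1`-jet `[L]^1_p`, identified with the tangent space `T_p L`. -/
def PointedSubmanifold.jet1 (P : PointedSubmanifold n m E) : GrassmannBundle n m E :=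
  ⟨P.pt, tangentPlane (Model n m) P.carrier P.pt, finrank_tangentPlane P⟩

theorem HasContact.jet1_eq {r : ℕ} (hr : 1 ≤ r) {P Q : PointedSubmanifold n m E}
    (h : HasContact r P Q) : P.jet1 = Q.jet1 := by
  obtain ⟨L, hL, p, hp⟩ := P
  obtain ⟨L', hL', p', hp'⟩ := Q
  obtain ⟨rfl : p = p', φ, f, g, hf, hg, hfg⟩ := h
  have h1 : fderiv ℝ f (φ p).1 = fderiv ℝ g (φ p).1 := by
    ext1 v
    have := congrArg (fun T => T (fun _ => v)) (hfg 1 hr)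
    simpa [iteratedFDeriv_one_apply] using this
  have h2 : tangentPlane (Model n m) L p = tangentPlane (Model n m) L' p := by
    apply Submodule.map_injective_of_injective (dChart_injective hf.mem_maximalAtlas hf.mem_source)
    rw [map_tangentPlane hp hf, map_tangentPlane hp' hg, h1]
  simp only [PointedSubmanifold.jet1, h2]

/-- The projection `π_{2,1} : J^2(E,n) → J^1(E,n)`, `[L]^2_p ↦ [L]^1_p`. -/
def jetProj : Jet n m E 2 → GrassmannBundle n m E :=
  Quot.lift PointedSubmanifold.jet1 fun _ _ h => h.jet1_eq one_le_two


end TangentGraph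

section GraphTransform

variable {X Y : Type*} [NormedAddCommGroup X] [NormedSpace ℝ X] [NormedAddCommGroup Y]
  [NormedSpace ℝ Y]

/-- The map `x ↦ (x, A x)`. -/
def graphEmb (A : X →L[ℝ] Y) : X →L[ℝ] X × Y :=
  ContinuousLinearMap.inl ℝ X Y + (ContinuousLinearMap.inr ℝ X Y).comp A

/-- The map `x ↦ pr₁ (T (x, A x))`. -/
def graphFst (T : X × Y →L[ℝ] X × Y) (A : X →L[ℝ] Y) : X →L[ℝ] X :=
  (ContinuousLinearMap.fst ℝ X Y).comp (T.comp (graphEmb A))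

/-- The map `x ↦ pr₂ (T (x, A x))`. -/
def graphSnd (T : X × Y →L[ℝ] X × Y) (A : X →L[ℝ] Y) : X →L[ℝ] Y :=
  (ContinuousLinearMap.snd ℝ X Y).comp (T.comp (graphEmb A))

theorem graphEmb_apply (A : X →L[ℝ] Y) (x : X) : graphEmb A x = (x, A x) := by
  simp [graphEmb]

theorem map_graph_eq_iff (T : X × Y →L[ℝ] X × Y) (A B : X →L[ℝ] Y) :
    A.toLinearMap.graph.map T.toLinearMap = B.toLinearMap.graph ↔
      (∀ x, graphSnd T A x = B (graphFst T A x)) ∧ Function.Surjective (graphFst T A) := by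
  constructor
  · intro h
    constructor
    · intro x
      have : T (x, A x) ∈ B.toLinearMap.graph := h ▸ Submodule.mem_map_of_mem (by simp)
      simpa [graphSnd, graphFst, graphEmb_apply] using this
    · intro x
      have : (x, B x) ∈ A.toLinearMap.graph.map T.toLinearMap := h ▸ by simp
      obtain ⟨⟨a, b⟩, hab, e⟩ := this
      obtain rfl : b = A a := by simpa using hab
      exact ⟨a, by simpa [graphFst, graphEmb_apply] using congrArg Prod.fst e⟩
  · rintro ⟨h1, h2⟩
    ext ⟨c, d⟩
    constructor
    · rintro ⟨⟨a, b⟩, hab, e⟩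
      obtain rfl : b = A a := by simpa using hab
      have := h1 a
      simp only [graphSnd, graphFst, graphEmb_apply, ContinuousLinearMap.comp_apply] at this
      change T (a, A a) = (c, d) at e
      rw [e] at this
      simpa using this
    · intro hcd
      obtain rfl : d = B c := by simpa using hcd
      obtain ⟨a, rfl⟩ := h2 c
      refine ⟨(a, A a), by simp, Prod.ext ?_ ?_⟩
      · simp [graphFst, graphEmb_apply]
      · rw [← h1]; simp [graphSnd, graphEmb_apply]

theorem exists_map_graph_iff [FiniteDimensional ℝ X] (T : X × Y →L[ℝ] X × Y)
    (A : X →L[ℝ] Y) :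
    (∃ B : X →L[ℝ] Y, A.toLinearMap.graph.map T.toLinearMap = B.toLinearMap.graph) ↔
      IsUnit (graphFst T A) := by
  have := FiniteDimensional.complete ℝ X
  have hsurj : Function.Surjective (graphFst T A) → IsUnit (graphFst T A) := fun h =>
    ContinuousLinearMap.isUnit_iff_bijective.2
      ⟨(LinearMap.injective_iff_surjective (f := (graphFst T A).toLinearMap)).2 h, h⟩
  constructor
  · rintro ⟨B, hB⟩
    exact hsurj ((map_graph_eq_iff T A B).1 hB).2
  · intro h
    refine ⟨(graphSnd T A).comp (Ring.inverse (graphFst T A)), (map_graph_eq_iff T A _).2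
      ⟨fun x => ?_, (ContinuousLinearMap.isUnit_iff_bijective.1 h).2⟩⟩
    have := congrArg (fun S => S x) (Ring.inverse_mul_cancel _ h)
    simp only [mul_apply_eq_comp, one_apply_eq_self] at this
    rw [ContinuousLinearMap.comp_apply, this]

theorem eq_of_map_graph {T : X × Y →L[ℝ] X × Y} {A B : X →L[ℝ] Y} (hu : IsUnit (graphFst T A))
    (h : A.toLinearMap.graph.map T.toLinearMap = B.toLinearMap.graph) :
    B = (graphSnd T A).comp (Ring.inverse (graphFst T A)) := by
  ext1 x
  have := congrArg (fun S => S x) (Ring.mul_inverse_cancel _ hu)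
  simp only [mul_apply_eq_comp, one_apply_eq_self] at this
  rw [ContinuousLinearMap.comp_apply, ((map_graph_eq_iff T A B).1 h).1, this]

theorem graph_injective {A B : X →L[ℝ] Y} (h : A.toLinearMap.graph = B.toLinearMap.graph) :
    A = B := by
  ext1 x
  have : (x, A x) ∈ B.toLinearMap.graph := h ▸ by simp
  simpa using this

theorem finrank_graph (A : X →L[ℝ] Y) :
    Module.finrank ℝ A.toLinearMap.graph = Module.finrank ℝ X := by
  rw [LinearMap.graph_eq_range_prod, LinearMap.finrank_range_of_inj]
  intro x y hxy
  exact congrArg Prod.fst hxy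

end GraphTransform

section GrassmannCharts

variable {n m : ℕ} {E : Type*} [TopologicalSpace E] [ChartedSpace (Model n m) E]

variable (n m) in
/-- The model space of `J^1(E,n)`, with coordinates `(u^λ, u^i; u^i_λ)`. -/
abbrev GrassmannModel : Type :=
  Model n m × (EuclideanSpace ℝ (Fin n) →L[ℝ] EuclideanSpace ℝ (Fin m))

/-- In the divided chart `φ`, the plane `θ` is the graph of `A = (u^i_λ)`. -/
def HasSlope (φ : OpenPartialHomeomorph E (Model n m)) (θ : GrassmannBundle n m E)
    (A : EuclideanSpace ℝ (Fin n) →L[ℝ] EuclideanSpace ℝ (Fin m)) : Prop :=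
  θ.plane.map (dChart φ θ.pt).toLinearMap = A.toLinearMap.graph

open Classical in
/-- The coordinates `(u^i_λ)` of `θ` in the divided chart `φ`. -/
def slope (φ : OpenPartialHomeomorph E (Model n m)) (θ : GrassmannBundle n m E) :
    EuclideanSpace ℝ (Fin n) →L[ℝ] EuclideanSpace ℝ (Fin m) :=
  if h : ∃ A, HasSlope φ θ A then h.choose else 0

theorem hasSlope_slope {φ : OpenPartialHomeomorph E (Model n m)} {θ : GrassmannBundle n m E}
    (h : ∃ A, HasSlope φ θ A) : HasSlope φ θ (slope φ θ) := by
  rw [slope, dif_pos h]; exact h.choose_spec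

theorem HasSlope.slope_eq {φ : OpenPartialHomeomorph E (Model n m)} {θ : GrassmannBundle n m E}
    {A : EuclideanSpace ℝ (Fin n) →L[ℝ] EuclideanSpace ℝ (Fin m)} (h : HasSlope φ θ A) :
    slope φ θ = A :=
  graph_injective ((hasSlope_slope ⟨A, h⟩).symm.trans h)

theorem finrank_map_dChartSymm {φ : OpenPartialHomeomorph E (Model n m)}
    (hφ : φ ∈ IsManifold.maximalAtlas 𝓘(ℝ, Model n m) ∞ E) {u : Model n m} (hu : u ∈ φ.target)
    (A : EuclideanSpace ℝ (Fin n) →L[ℝ] EuclideanSpace ℝ (Fin m)) :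
    Module.finrank ℝ (A.toLinearMap.graph.map (dChartSymm φ u).toLinearMap) = n := by
  have hinj : Function.Injective (dChartSymm φ u) := fun v w e => by
    rw [← dChart_dChartSymm hφ hu v, e, dChart_dChartSymm hφ hu w]
  rw [← LinearEquiv.finrank_eq (Submodule.equivMapOfInjective
    (dChartSymm φ u).toLinearMap hinj A.toLinearMap.graph), finrank_graph,
    finrank_euclideanSpace_fin]

variable (n m) in
/-- An arbitrary `n`-plane at `p`, used only as a default value. -/
def defaultPlane (p : E) : GrassmannBundle n m E :=
  ⟨p, (0 : EuclideanSpace ℝ (Fin n) →L[ℝ] EuclideanSpace ℝ (Fin m)).toLinearMap.graph,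
    (finrank_graph _).trans finrank_euclideanSpace_fin⟩

open Classical in
/-- The `n`-plane whose coordinates in the divided chart `φ` are `z`. -/
def planeOfSlope (φ : OpenPartialHomeomorph E (Model n m))
    (hφ : φ ∈ IsManifold.maximalAtlas 𝓘(ℝ, Model n m) ∞ E) (z : GrassmannModel n m) :
    GrassmannBundle n m E :=
  if hz : z.1 ∈ φ.target then
    ⟨φ.symm z.1, z.2.toLinearMap.graph.map (dChartSymm φ z.1).toLinearMap,
      finrank_map_dChartSymm hφ hz z.2⟩
  else defaultPlane n m (φ.symm z.1)

theorem planeOfSlope_of_mem {φ : OpenPartialHomeomorph E (Model n m)}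
    (hφ : φ ∈ IsManifold.maximalAtlas 𝓘(ℝ, Model n m) ∞ E) {z : GrassmannModel n m}
    (hz : z.1 ∈ φ.target) : planeOfSlope φ hφ z =
      ⟨φ.symm z.1, z.2.toLinearMap.graph.map (dChartSymm φ z.1).toLinearMap,
        finrank_map_dChartSymm hφ hz z.2⟩ := dif_pos hz

theorem hasSlope_planeOfSlope {φ : OpenPartialHomeomorph E (Model n m)}
    (hφ : φ ∈ IsManifold.maximalAtlas 𝓘(ℝ, Model n m) ∞ E) {z : GrassmannModel n m}
    (hz : z.1 ∈ φ.target) : HasSlope φ (planeOfSlope φ hφ z) z.2 := by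
  rw [planeOfSlope_of_mem hφ hz]
  unfold HasSlope
  rw [← Submodule.map_comp]
  convert! Submodule.map_id _
  exact LinearMap.ext (dChart_dChartSymm hφ hz)

theorem GrassmannBundle.eq_of_hasSlope {φ : OpenPartialHomeomorph E (Model n m)}
    (hφ : φ ∈ IsManifold.maximalAtlas 𝓘(ℝ, Model n m) ∞ E) {θ θ' : GrassmannBundle n m E}
    (hθ : θ.pt ∈ φ.source) (hpt : θ.pt = θ'.pt)
    {A : EuclideanSpace ℝ (Fin n) →L[ℝ] EuclideanSpace ℝ (Fin m)}
    (h : HasSlope φ θ A) (h' : HasSlope φ θ' A) : θ = θ' := by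
  obtain ⟨p, W, hW⟩ := θ
  obtain ⟨p', W', hW'⟩ := θ'
  obtain rfl : p = p' := hpt
  have : W = W' := Submodule.map_injective_of_injective (dChart_injective hφ hθ) (h.trans h'.symm)
  subst this
  rfl

/-- The chart `(u^λ, u^i; u^i_λ)` of `J^1(E,n)` induced by the divided chart `φ`; its domain
consists of the planes to which `φ` is concordant. -/
def grassmannChart (φ : OpenPartialHomeomorph E (Model n m))
    (hφ : φ ∈ IsManifold.maximalAtlas 𝓘(ℝ, Model n m) ∞ E) :
    PartialEquiv (GrassmannBundle n m E) (GrassmannModel n m) where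
  toFun θ := (φ θ.pt, slope φ θ)
  invFun := planeOfSlope φ hφ
  source := {θ | θ.pt ∈ φ.source ∧ ∃ A, HasSlope φ θ A}
  target := {z | z.1 ∈ φ.target}
  map_source' θ hθ := φ.map_source hθ.1
  map_target' z hz := ⟨by rw [planeOfSlope_of_mem hφ hz]; exact φ.map_target hz,
    z.2, hasSlope_planeOfSlope hφ hz⟩
  left_inv' θ hθ := by
    have h1 := hasSlope_planeOfSlope hφ (z := (φ θ.pt, slope φ θ)) (φ.map_source hθ.1)
    have h2 : (planeOfSlope φ hφ (φ θ.pt, slope φ θ)).pt = θ.pt := by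
      rw [planeOfSlope_of_mem hφ (φ.map_source hθ.1)]; exact φ.left_inv hθ.1
    exact (GrassmannBundle.eq_of_hasSlope hφ hθ.1 h2.symm (hasSlope_slope hθ.2) h1).symm
  right_inv' z hz := Prod.ext
    (by rw [planeOfSlope_of_mem hφ hz]; exact φ.right_inv hz)
    (hasSlope_planeOfSlope hφ hz).slope_eq

/-- The derivative of a change of divided charts. -/
def changeDeriv (φ ψ : OpenPartialHomeomorph E (Model n m)) (u : Model n m) :
    Model n m →L[ℝ] Model n m := fderiv ℝ (ψ ∘ φ.symm) u

theorem changeDeriv_eq {φ ψ : OpenPartialHomeomorph E (Model n m)}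
    (hφ : φ ∈ IsManifold.maximalAtlas 𝓘(ℝ, Model n m) ∞ E)
    (hψ : ψ ∈ IsManifold.maximalAtlas 𝓘(ℝ, Model n m) ∞ E) {u : Model n m}
    (hu : u ∈ (φ.symm.trans ψ).source) :
    changeDeriv φ ψ u = (dChart ψ (φ.symm u)).comp (dChartSymm φ u) := by
  rw [OpenPartialHomeomorph.trans_source] at hu
  have h : HasFDerivAt (ψ ∘ φ.symm) ((dChart ψ (φ.symm u)).comp (dChartSymm φ u) :
      Model n m →L[ℝ] Model n m) u :=
    hasMFDerivAt_iff_hasFDerivAt.1 ((mdiff_of_mem hψ hu.2).hasMFDerivAt.comp u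
      (mdiff_symm_of_mem hφ hu.1).hasMFDerivAt)
  exact h.fderiv

theorem contDiffOn_change [IsManifold 𝓘(ℝ, Model n m) ∞ E]
    {φ ψ : OpenPartialHomeomorph E (Model n m)}
    (hφ : φ ∈ IsManifold.maximalAtlas 𝓘(ℝ, Model n m) ∞ E)
    (hψ : ψ ∈ IsManifold.maximalAtlas 𝓘(ℝ, Model n m) ∞ E) :
    ContDiffOn ℝ ∞ (ψ ∘ φ.symm) (φ.symm.trans ψ).source := by
  rw [← contMDiffOn_iff_contDiffOn, OpenPartialHomeomorph.trans_source]
  exact (contMDiffOn_of_mem_maximalAtlas hψ).comp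
    ((contMDiffOn_symm_of_mem_maximalAtlas hφ).mono inter_subset_left) inter_subset_right

theorem contDiffOn_changeDeriv [IsManifold 𝓘(ℝ, Model n m) ∞ E]
    {φ ψ : OpenPartialHomeomorph E (Model n m)}
    (hφ : φ ∈ IsManifold.maximalAtlas 𝓘(ℝ, Model n m) ∞ E)
    (hψ : ψ ∈ IsManifold.maximalAtlas 𝓘(ℝ, Model n m) ∞ E) :
    ContDiffOn ℝ ∞ (changeDeriv φ ψ) (φ.symm.trans ψ).source :=
  (contDiffOn_change hφ hψ).fderiv_of_isOpen (φ.symm.trans ψ).open_source (by simp)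

theorem map_plane_planeOfSlope {φ ψ : OpenPartialHomeomorph E (Model n m)}
    (hφ : φ ∈ IsManifold.maximalAtlas 𝓘(ℝ, Model n m) ∞ E)
    (hψ : ψ ∈ IsManifold.maximalAtlas 𝓘(ℝ, Model n m) ∞ E) {z : GrassmannModel n m}
    (hz : z.1 ∈ (φ.symm.trans ψ).source)
    (B : EuclideanSpace ℝ (Fin n) →L[ℝ] EuclideanSpace ℝ (Fin m)) :
    HasSlope ψ (planeOfSlope φ hφ z) B ↔
      z.2.toLinearMap.graph.map (changeDeriv φ ψ z.1).toLinearMap = B.toLinearMap.graph := by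
  rw [changeDeriv_eq hφ hψ hz]
  rw [OpenPartialHomeomorph.trans_source] at hz
  rw [planeOfSlope_of_mem hφ hz.1]
  unfold HasSlope
  rw [← Submodule.map_comp]
  rfl

theorem source_change [IsManifold 𝓘(ℝ, Model n m) ∞ E]
    {φ ψ : OpenPartialHomeomorph E (Model n m)}
    (hφ : φ ∈ IsManifold.maximalAtlas 𝓘(ℝ, Model n m) ∞ E)
    (hψ : ψ ∈ IsManifold.maximalAtlas 𝓘(ℝ, Model n m) ∞ E) :
    ((grassmannChart φ hφ).symm.trans (grassmannChart ψ hψ)).source =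
      {z | z.1 ∈ (φ.symm.trans ψ).source ∧ IsUnit (graphFst (changeDeriv φ ψ z.1) z.2)} := by
  ext z
  have hpt (hz : z.1 ∈ φ.target) : (planeOfSlope φ hφ z).pt = φ.symm z.1 := by
    rw [planeOfSlope_of_mem hφ hz]
  have key (hz : z.1 ∈ (φ.symm.trans ψ).source) : (∃ A, HasSlope ψ (planeOfSlope φ hφ z) A) ↔
      IsUnit (graphFst (changeDeriv φ ψ z.1) z.2) := by
    rw [← exists_map_graph_iff]
    exact exists_congr fun B => map_plane_planeOfSlope hφ hψ hz B
  constructor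
  · rintro ⟨h1, h2, h3⟩
    have hz : z.1 ∈ (φ.symm.trans ψ).source := by
      rw [OpenPartialHomeomorph.trans_source]; exact ⟨h1, (hpt h1).subst (motive := (· ∈ ψ.source)) h2⟩
    exact ⟨hz, (key hz).1 h3⟩
  · rintro ⟨hz, h3⟩
    have hz' := hz
    rw [OpenPartialHomeomorph.trans_source] at hz'
    exact ⟨hz'.1, (hpt hz'.1).symm ▸ hz'.2, (key hz).2 h3⟩

theorem contDiffOn_graphFst [IsManifold 𝓘(ℝ, Model n m) ∞ E]
    {φ ψ : OpenPartialHomeomorph E (Model n m)}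
    (hφ : φ ∈ IsManifold.maximalAtlas 𝓘(ℝ, Model n m) ∞ E)
    (hψ : ψ ∈ IsManifold.maximalAtlas 𝓘(ℝ, Model n m) ∞ E) :
    ContDiffOn ℝ ∞ (fun z : GrassmannModel n m => graphFst (changeDeriv φ ψ z.1) z.2)
      {z | z.1 ∈ (φ.symm.trans ψ).source} := by
  have h1 : ContDiffOn ℝ ∞ (fun z : GrassmannModel n m => changeDeriv φ ψ z.1)
      {z | z.1 ∈ (φ.symm.trans ψ).source} :=
    (contDiffOn_changeDeriv hφ hψ).comp contDiff_fst.contDiffOn fun z hz => hz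
  have h2 : ContDiffOn ℝ ∞ (fun z : GrassmannModel n m => graphEmb z.2)
      {z | z.1 ∈ (φ.symm.trans ψ).source} :=
    (contDiff_const.add ((contDiff_const (c := ContinuousLinearMap.inr ℝ
      (EuclideanSpace ℝ (Fin n)) (EuclideanSpace ℝ (Fin m)))).clm_comp contDiff_snd)).contDiffOn
  exact contDiffOn_const.clm_comp (h1.clm_comp h2)

theorem contDiffOn_graphSnd [IsManifold 𝓘(ℝ, Model n m) ∞ E]
    {φ ψ : OpenPartialHomeomorph E (Model n m)}
    (hφ : φ ∈ IsManifold.maximalAtlas 𝓘(ℝ, Model n m) ∞ E)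
    (hψ : ψ ∈ IsManifold.maximalAtlas 𝓘(ℝ, Model n m) ∞ E) :
    ContDiffOn ℝ ∞ (fun z : GrassmannModel n m => graphSnd (changeDeriv φ ψ z.1) z.2)
      {z | z.1 ∈ (φ.symm.trans ψ).source} := by
  have h1 : ContDiffOn ℝ ∞ (fun z : GrassmannModel n m => changeDeriv φ ψ z.1)
      {z | z.1 ∈ (φ.symm.trans ψ).source} :=
    (contDiffOn_changeDeriv hφ hψ).comp contDiff_fst.contDiffOn fun z hz => hz
  have h2 : ContDiffOn ℝ ∞ (fun z : GrassmannModel n m => graphEmb z.2)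
      {z | z.1 ∈ (φ.symm.trans ψ).source} :=
    (contDiff_const.add ((contDiff_const (c := ContinuousLinearMap.inr ℝ
      (EuclideanSpace ℝ (Fin n)) (EuclideanSpace ℝ (Fin m)))).clm_comp contDiff_snd)).contDiffOn
  exact contDiffOn_const.clm_comp (h1.clm_comp h2)

theorem contDiffOn_chartChange [IsManifold 𝓘(ℝ, Model n m) ∞ E]
    {φ ψ : OpenPartialHomeomorph E (Model n m)}
    (hφ : φ ∈ IsManifold.maximalAtlas 𝓘(ℝ, Model n m) ∞ E)
    (hψ : ψ ∈ IsManifold.maximalAtlas 𝓘(ℝ, Model n m) ∞ E) :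
    ContDiffOn ℝ ∞ ((grassmannChart φ hφ).symm.trans (grassmannChart ψ hψ))
      ((grassmannChart φ hφ).symm.trans (grassmannChart ψ hψ)).source := by
  have hsub : ((grassmannChart φ hφ).symm.trans (grassmannChart ψ hψ)).source ⊆
      {z | z.1 ∈ (φ.symm.trans ψ).source} := by
    rw [source_change]; exact fun z hz => hz.1
  have h1 : ContDiffOn ℝ ∞ (fun z : GrassmannModel n m => (ψ ∘ φ.symm) z.1)
      ((grassmannChart φ hφ).symm.trans (grassmannChart ψ hψ)).source :=
    (contDiffOn_change hφ hψ).comp contDiff_fst.contDiffOn fun z hz => hsub hz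
  have h2 : ContDiffOn ℝ ∞ (fun z : GrassmannModel n m =>
      (graphSnd (changeDeriv φ ψ z.1) z.2).comp
        (Ring.inverse (graphFst (changeDeriv φ ψ z.1) z.2)))
      ((grassmannChart φ hφ).symm.trans (grassmannChart ψ hψ)).source := by
    refine ((contDiffOn_graphSnd hφ hψ).mono hsub).clm_comp fun z hz => ?_
    have hz' := hz
    rw [source_change] at hz'
    obtain ⟨u, hu⟩ := hz'.2
    have h3 := (contDiffOn_graphFst hφ hψ).mono hsub z hz
    have h4 : ContDiffAt ℝ ∞ (Ring.inverse (M₀ :=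
        EuclideanSpace ℝ (Fin n) →L[ℝ] EuclideanSpace ℝ (Fin n)))
        (graphFst (changeDeriv φ ψ z.1) z.2) := hu ▸ contDiffAt_ringInverse ℝ u
    exact h4.comp_contDiffWithinAt z h3
  refine (h1.prodMk h2).congr fun z hz => ?_
  have hz' := hz
  rw [source_change] at hz'
  have hz1 : z.1 ∈ φ.target := hz.1
  refine Prod.ext ?_ ?_
  · change ψ (planeOfSlope φ hφ z).pt = ψ (φ.symm z.1)
    rw [planeOfSlope_of_mem hφ hz1]
  exact eq_of_map_graph hz'.2
    ((map_plane_planeOfSlope hφ hψ hz'.1 _).1 (hasSlope_slope hz.2.2))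

theorem isOpen_source_change [IsManifold 𝓘(ℝ, Model n m) ∞ E]
    {φ ψ : OpenPartialHomeomorph E (Model n m)}
    (hφ : φ ∈ IsManifold.maximalAtlas 𝓘(ℝ, Model n m) ∞ E)
    (hψ : ψ ∈ IsManifold.maximalAtlas 𝓘(ℝ, Model n m) ∞ E) :
    IsOpen ((grassmannChart φ hφ).symm.trans (grassmannChart ψ hψ)).source := by
  rw [source_change]
  have h : IsOpen {z : GrassmannModel n m | z.1 ∈ (φ.symm.trans ψ).source} :=
    (φ.symm.trans ψ).open_source.preimage continuous_fst
  exact (contDiffOn_graphFst hφ hψ).continuousOn.isOpen_inter_preimage h Units.isOpen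

/-- Every `n`-plane of the model space is carried to a graph by a linear automorphism. -/
theorem exists_linear_graph (W : Submodule ℝ (Model n m)) (hW : Module.finrank ℝ W = n) :
    ∃ G : Model n m ≃L[ℝ] Model n m, W.map G.toLinearEquiv.toLinearMap =
      (0 : EuclideanSpace ℝ (Fin n) →L[ℝ] EuclideanSpace ℝ (Fin m)).toLinearMap.graph := by
  obtain ⟨C, hC⟩ := W.exists_isCompl
  have hC' : Module.finrank ℝ C = m := by
    have := Submodule.finrank_add_eq_of_isCompl hC
    simp [hW, Module.finrank_prod] at this
    omega
  let e1 : W ≃ₗ[ℝ] EuclideanSpace ℝ (Fin n) :=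
    LinearEquiv.ofFinrankEq _ _ (by rw [hW, finrank_euclideanSpace_fin])
  let e2 : C ≃ₗ[ℝ] EuclideanSpace ℝ (Fin m) :=
    LinearEquiv.ofFinrankEq _ _ (by rw [hC', finrank_euclideanSpace_fin])
  let G : Model n m ≃ₗ[ℝ] Model n m :=
    (Submodule.prodEquivOfIsCompl W C hC).symm.trans (e1.prodCongr e2)
  refine ⟨G.toContinuousLinearEquiv, ?_⟩
  have key (w : W) : G w = (e1 w, 0) := by simp [G]
  ext ⟨a, b⟩
  constructor
  · rintro ⟨w, hw, e⟩
    have := (key ⟨w, hw⟩).symm.trans e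
    simpa using (congrArg Prod.snd this).symm
  · intro hb
    obtain rfl : b = 0 := by simpa using hb
    exact ⟨e1.symm a, (e1.symm a).2, (key _).trans (by simp)⟩

theorem exists_dividedChart [IsManifold 𝓘(ℝ, Model n m) ∞ E] (θ : GrassmannBundle n m E) :
    ∃ φ : OpenPartialHomeomorph E (Model n m),
      φ ∈ IsManifold.maximalAtlas 𝓘(ℝ, Model n m) ∞ E ∧ θ.pt ∈ φ.source ∧
      ∃ A, HasSlope φ θ A := by
  let c := chartAt (Model n m) θ.pt
  have hc : c ∈ IsManifold.maximalAtlas 𝓘(ℝ, Model n m) ∞ E :=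
    IsManifold.chart_mem_maximalAtlas θ.pt
  have hcs : θ.pt ∈ c.source := mem_chart_source _ _
  obtain ⟨G, hG⟩ := exists_linear_graph (θ.plane.map (dChart c θ.pt).toLinearMap) (by
    rw [← LinearEquiv.finrank_eq (Submodule.equivMapOfInjective
      (dChart c θ.pt).toLinearMap (dChart_injective hc hcs) θ.plane), θ.finrank_plane])
  let φ := c.trans G.toHomeomorph.toOpenPartialHomeomorph
  have hφ : φ ∈ IsManifold.maximalAtlas 𝓘(ℝ, Model n m) ∞ E := by
    apply OpenPartialHomeomorph.mem_maximalAtlas_of_contMDiffOn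
    · have : ContMDiffOn 𝓘(ℝ, Model n m) 𝓘(ℝ, Model n m) ∞ (G ∘ c) c.source :=
        G.contDiff.contMDiff.comp_contMDiffOn (contMDiffOn_of_mem_maximalAtlas hc)
      simpa [φ] using this
    · have : ContMDiffOn 𝓘(ℝ, Model n m) 𝓘(ℝ, Model n m) ∞ (c.symm ∘ G.symm)
          (G.symm ⁻¹' c.target) :=
        (contMDiffOn_symm_of_mem_maximalAtlas hc).comp G.symm.contDiff.contMDiff.contMDiffOn
          fun z hz => hz
      simpa [φ] using this
  refine ⟨φ, hφ, by simpa [φ] using hcs, 0, ?_⟩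
  have hd : dChart φ θ.pt = (G : Model n m →L[ℝ] Model n m).comp (dChart c θ.pt) := by
    have h1 : HasMFDerivAt 𝓘(ℝ, Model n m) 𝓘(ℝ, Model n m) G (c θ.pt)
        (G : Model n m →L[ℝ] Model n m) := G.hasFDerivAt.hasMFDerivAt
    exact (h1.comp θ.pt (mdiff_of_mem hc hcs).hasMFDerivAt).mfderiv
  unfold HasSlope
  rw [hd, ← hG]
  exact Submodule.map_comp _ _ _

/-- The atlas of `J^1(E,n)` made of the charts induced by all divided charts of `E`. -/
def grassmannCore [IsManifold 𝓘(ℝ, Model n m) ∞ E] :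
    ChartedSpaceCore (GrassmannModel n m) (GrassmannBundle n m E) where
  atlas := {e | ∃ (φ : OpenPartialHomeomorph E (Model n m))
    (hφ : φ ∈ IsManifold.maximalAtlas 𝓘(ℝ, Model n m) ∞ E), e = grassmannChart φ hφ}
  chartAt θ := grassmannChart (exists_dividedChart θ).choose
    (exists_dividedChart θ).choose_spec.1
  mem_chart_source θ := (exists_dividedChart θ).choose_spec.2
  chart_mem_atlas θ := ⟨_, _, rfl⟩
  open_source := by
    rintro _ _ ⟨φ, hφ, rfl⟩ ⟨ψ, hψ, rfl⟩
    exact isOpen_source_change hφ hψ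
  continuousOn_toFun := by
    rintro _ _ ⟨φ, hφ, rfl⟩ ⟨ψ, hψ, rfl⟩
    exact (contDiffOn_chartChange hφ hψ).continuousOn

instance [IsManifold 𝓘(ℝ, Model n m) ∞ E] : TopologicalSpace (GrassmannBundle n m E) :=
  grassmannCore.toTopologicalSpace

instance [IsManifold 𝓘(ℝ, Model n m) ∞ E] :
    ChartedSpace (GrassmannModel n m) (GrassmannBundle n m E) :=
  grassmannCore.toChartedSpace

instance [IsManifold 𝓘(ℝ, Model n m) ∞ E] :
    IsManifold 𝓘(ℝ, GrassmannModel n m) ∞ (GrassmannBundle n m E) := by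
  apply isManifold_of_contDiffOn
  intro e e' he he'
  obtain ⟨_, ⟨φ, rfl⟩, hφ⟩ := he
  obtain ⟨_, ⟨⟨φ, hφ', rfl⟩, rfl⟩, rfl⟩ := hφ
  obtain ⟨_, ⟨ψ, rfl⟩, hψ⟩ := he'
  obtain ⟨_, ⟨⟨ψ, hψ', rfl⟩, rfl⟩, rfl⟩ := hψ
  simpa using! contDiffOn_chartChange hφ' hψ'

end GrassmannCharts

section Connections

variable {n m : ℕ} {E : Type*} [TopologicalSpace E] [ChartedSpace (Model n m) E]
  [IsManifold 𝓘(ℝ, Model n m) ∞ E]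

variable (n m E) in
/-- Linear connections on `TE → E`, given by their covariant derivative. -/
abbrev LinearConnection : Type _ :=
  CovariantDerivative 𝓘(ℝ, Model n m) (Model n m)
    (fun p : E => TangentSpace 𝓘(ℝ, Model n m) p)

/-- The vertical projection `υ_Γ : T(TE) → TE` of `Γ`. In a local trivialization of `TE` with
basis `p_k` and fibre coordinates `η^k` it is `(dη^k + Γ_A^k_B η^B du^A) ⊗ p_k`: the second term is
the covariant derivative of the vector field with the same, constant, components as `w`. -/
def verticalProj (Γ : LinearConnection n m E) (w : TangentBundle 𝓘(ℝ, Model n m) E)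
    (ξ : TangentSpace 𝓘(ℝ, Model n m).tangent w) : TangentSpace 𝓘(ℝ, Model n m) w.proj :=
  let e := trivializationAt (Model n m)
    (fun p : E => TangentSpace 𝓘(ℝ, Model n m) p) w.proj
  e.symm w.proj
      (mfderiv 𝓘(ℝ, Model n m).tangent 𝓘(ℝ, Model n m) (fun w' => (e w').2) w ξ) +
    Γ (fun q => e.symm q (e w).2) w.proj
      (mfderiv 𝓘(ℝ, Model n m).tangent 𝓘(ℝ, Model n m)
        (fun w' : TangentBundle 𝓘(ℝ, Model n m) E => w'.proj) w ξ)

/-- The covariant derivative `∇[f^*Γ]_v s = υ_Γ (Ts (v))` of the pull-back connection on the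
pull-back bundle `f^*(TE)`, for a section `s` of it, that is a vector field along `f : N → E`. -/
def pullbackCov (Γ : LinearConnection n m E) {B N : Type*} [NormedAddCommGroup B]
    [NormedSpace ℝ B] [TopologicalSpace N] [ChartedSpace B N] (f : N → E)
    (s : ∀ y, TangentSpace 𝓘(ℝ, Model n m) (f y)) (y : N) (v : TangentSpace 𝓘(ℝ, B) y) :
    TangentSpace 𝓘(ℝ, Model n m) (f y) :=
  verticalProj Γ ⟨f y, s y⟩ (mfderiv 𝓘(ℝ, B) 𝓘(ℝ, Model n m).tangent
    (fun y' => (⟨f y', s y'⟩ : TangentBundle 𝓘(ℝ, Model n m) E)) y v)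

/-! ### The equation of totally geodesic submanifolds -/

/-- `Y` is a vector field, smooth at the base point `p` of `P` and tangent to the submanifold `L`
at the points of `L` near `p`. -/
structure PointedSubmanifold.IsTangentField (P : PointedSubmanifold n m E)
    (Y : ∀ q : E, TangentSpace 𝓘(ℝ, Model n m) q) : Prop where
  contMDiffAt : ContMDiffAt 𝓘(ℝ, Model n m) 𝓘(ℝ, Model n m).tangent ∞
    (fun q => (⟨q, Y q⟩ : TangentBundle 𝓘(ℝ, Model n m) E)) P.pt
  tangent : ∀ᶠ q in 𝓝 P.pt, q ∈ P.carrier → Y q ∈ tangentPlane (Model n m) P.carrier q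

/-- The second fundamental form `II_L(X, Y) = ω(∇_X Y) ∈ T_pE / T_pL` of `L` at `p`, where
`X ∈ T_pL` and `Y` is a vector field tangent to `L`. It is the value at `[L]^2_p` of the universal
second fundamental form on `J^2(E,n)`. -/
def secondFundamentalForm (Γ : LinearConnection n m E) (P : PointedSubmanifold n m E)
    (X : tangentPlane (Model n m) P.carrier P.pt)
    (Y : ∀ q : E, TangentSpace 𝓘(ℝ, Model n m) q) :
    TangentSpace 𝓘(ℝ, Model n m) P.pt ⧸ tangentPlane (Model n m) P.carrier P.pt :=
  (tangentPlane (Model n m) P.carrier P.pt).mkQ (Γ Y P.pt X)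

/-- The equation `II = 0` of (unparametrized) `n`-dimensional totally geodesic submanifolds, a
subset of `J^2(E,n)`. -/
def totallyGeodesicEquation (Γ : LinearConnection n m E) : Set (Jet n m E 2) :=
  {j | ∃ P : PointedSubmanifold n m E, P.jet 2 = j ∧
    ∀ X Y, P.IsTangentField Y → secondFundamentalForm Γ P X Y = 0}

/-- Two connections are `n`-Grassmannian equivalent if they have the same equation of
`n`-dimensional totally geodesic submanifolds. -/
def IsGrassmannianEquivalent (Γ Γ' : LinearConnection n m E) : Prop :=
  totallyGeodesicEquation Γ = totallyGeodesicEquation Γ'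

/-! ### The connection on `π_{1,0}` and the associated section of `π_{2,1}` -/

/-- `Y` is a section of the tautological subbundle `H^{1,0} = {(θ, w) | w ∈ θ}` of the pull-back
`T^{1,0}` of `TE` to `J^1(E,n)`, and it is smooth at `θ`. -/
structure IsTautologicalSectionAt (Y : ∀ θ : GrassmannBundle n m E,
    TangentSpace 𝓘(ℝ, Model n m) θ.pt) (θ : GrassmannBundle n m E) : Prop where
  mem_plane : ∀ θ', Y θ' ∈ θ'.plane
  contMDiffAt : ContMDiffAt 𝓘(ℝ, GrassmannModel n m) 𝓘(ℝ, Model n m).tangent ∞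
    (fun θ' => (⟨θ'.pt, Y θ'⟩ : TangentBundle 𝓘(ℝ, Model n m) E)) θ

/-- The vertical projection `TJ^1(E,n) → Hom(H^{1,0}, V^{1,0})`, `V^{1,0} = T^{1,0} / H^{1,0}`, of
the connection `Γ̇` on `π_{1,0}` induced by `Γ`: at `v ∈ T_θ J^1(E,n)` and at the value at `θ` of a
section `Y` of `H^{1,0}` it is `ω(∇_v (D Y))`, where `D : H^{1,0} → T^{1,0}` is the inclusion,
`∇` is the pull-back of `Γ` and `ω : T^{1,0} → V^{1,0}` is the quotient map. If `Ξ` is any linear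
connection on `H^{1,0}`, then `(∇_v D)(Y) = ∇_v (D Y) - D (∇[Ξ]_v Y)`, where the last term is
killed by `ω`; so this is `ω ∘ (∇_v D)`. -/
def dotVerticalProj (Γ : LinearConnection n m E) (θ : GrassmannBundle n m E)
    (v : TangentSpace 𝓘(ℝ, GrassmannModel n m) θ)
    (Y : ∀ θ : GrassmannBundle n m E, TangentSpace 𝓘(ℝ, Model n m) θ.pt) :
    TangentSpace 𝓘(ℝ, Model n m) θ.pt ⧸ θ.plane :=
  θ.plane.mkQ (pullbackCov Γ GrassmannBundle.pt Y θ v)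

/-- `v` is a horizontal lift of `w ∈ T_pE` to `θ ∈ J^1(E,n)`, `p = π_{1,0}(θ)`, with respect to
`Γ̇`. -/
def IsHorizontalLift (Γ : LinearConnection n m E) (θ : GrassmannBundle n m E)
    (w : TangentSpace 𝓘(ℝ, Model n m) θ.pt)
    (v : TangentSpace 𝓘(ℝ, GrassmannModel n m) θ) : Prop :=
  mfderiv 𝓘(ℝ, GrassmannModel n m) 𝓘(ℝ, Model n m) GrassmannBundle.pt θ v = w ∧
    ∀ Y, IsTautologicalSectionAt Y θ → dotVerticalProj Γ θ v Y = 0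

/-- The first prolongation `L^{(1)} = {[L]^1_q | q ∈ L}` of the submanifold `L`. -/
def PointedSubmanifold.prolongation (P : PointedSubmanifold n m E) :
    Set (GrassmannBundle n m E) :=
  {θ | θ.pt ∈ P.carrier ∧ θ.plane = tangentPlane (Model n m) P.carrier θ.pt}

/-- The `R`-plane `R_{[L]^2_p} = T_{[L]^1_p} L^{(1)}`. -/
def PointedSubmanifold.rPlane (P : PointedSubmanifold n m E) :
    Submodule ℝ (TangentSpace 𝓘(ℝ, GrassmannModel n m) P.jet1) :=
  tangentPlane (GrassmannModel n m) P.prolongation P.jet1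

/-- `s` is the section `Γ̈` of `π_{2,1}` associated with `Γ`, that is the `n`-Grassmannian structure
of `Γ`: with `Γ̈(θ) = [L]^2_p`, the inclusion `D² : θ = T_pL ≃ R_{Γ̈(θ)} → T_θ J^1(E,n)` sends every
`w ∈ θ` to its `Γ̇`-horizontal lift (`D² ∘ Γ̈ = D¹ ⌟ Γ̇`). Here `D²(w)` is the vector of the `R`-plane
that projects to `w`. -/
def IsGrassmannianStructure (Γ : LinearConnection n m E)
    (s : GrassmannBundle n m E → Jet n m E 2) : Prop :=
  ∀ θ, jetProj (s θ) = θ ∧ ∃ P : PointedSubmanifold n m E, P.jet 2 = s θ ∧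
    ∀ w ∈ P.jet1.plane, ∃ v ∈ P.rPlane, IsHorizontalLift Γ P.jet1 w v

end Connections
end
end SubmanifoldJet

/-! Near `p`, write `L` in a divided chart as the graph of `f`, with slope `A = Df`. For `Y` tangent
to `L`, differentiating the tangency relation `Y₂ = Df(Y₁)` along `L` shows that the class of `∇_X
Y` modulo `T_pL` vanishes exactly when `D²f(a, b) + slopeForm A (a, b) = 0`, where `a`, `b` are the
first components of `X`, `Y(p)` and `slopeForm` depends only on the connection and on the tangent
plane (`isTotallyGeodesicAt_iff`). So vanishing of the second fundamental form prescribes the second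
derivatives as a function of the 1-jet. This determines at most one 2-jet over each plane
(`jet_two_eq`). It can be solved because torsion-freeness makes `slopeForm` symmetric, as a Hessian
must be (`exists_isTotallyGeodesicAt`). Hence `totallyGeodesicEquation` is the image of a unique
section of `π_{2,1}`.

That section is `Γ̈`. The plane `R_{[L]^2_p}` is the image of `T_pL` under the differential of the
prolongation `q ↦ [L]^1_q`. By the chain rule, the vertical projection of the image of `w`,
evaluated on a tautological section `Y`, is the second fundamental form on `w` and the restriction
of `Y` to `L^{(1)}`. Thus `R` consists of horizontal lifts exactly when the second fundamental form
vanishes (`forall_isHorizontalLift_iff`). The equivalence follows, since a section is determined by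
its image. -/

namespace SubmanifoldJet
noncomputable section

/-! ### Smoothness of tangent maps. -/

section TangentMaps

variable {B M B' M' : Type*} [NormedAddCommGroup B] [NormedSpace ℝ B] [TopologicalSpace M]
  [ChartedSpace B M] [IsManifold 𝓘(ℝ, B) ∞ M] [NormedAddCommGroup B'] [NormedSpace ℝ B']
  [TopologicalSpace M'] [ChartedSpace B' M'] [IsManifold 𝓘(ℝ, B') ∞ M']

/-- Local version for maps smooth only on an open set, such as charts and their inverses: over `U`
the tangent map agrees with the one taken within `U`. -/
theorem contMDiffAt_tangentMap {f : M → M'} {U : Set M} (hU : IsOpen U)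
    (hf : ContMDiffOn 𝓘(ℝ, B) 𝓘(ℝ, B') ∞ f U) {w : TangentBundle 𝓘(ℝ, B) M} (hw : w.proj ∈ U) :
    ContMDiffAt 𝓘(ℝ, B).tangent 𝓘(ℝ, B').tangent ∞ (tangentMap 𝓘(ℝ, B) 𝓘(ℝ, B') f) w := by
  have : IsManifold 𝓘(ℝ, B) 1 M := .of_le (n := ∞) (by simp)
  have : IsManifold 𝓘(ℝ, B') 1 M' := .of_le (n := ∞) (by simp)
  have hopen : IsOpen (TotalSpace.proj ⁻¹' U : Set (TangentBundle 𝓘(ℝ, B) M)) :=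
    hU.preimage (FiberBundle.continuous_proj B _)
  have h := (hf.contMDiffOn_tangentMapWithin (m := ∞) (by simp) hU.uniqueMDiffOn).contMDiffAt
    (hopen.mem_nhds hw)
  refine h.congr_of_eventuallyEq ?_
  filter_upwards [hopen.mem_nhds hw] with x hx
  simp only [tangentMap, tangentMapWithin, mfderivWithin_of_isOpen hU hx]

omit [IsManifold 𝓘(ℝ, B) ∞ M] in
/-- Two pairs of a point and a tangent vector at it agree if the points do and the vectors agree
as elements of the model space. -/
theorem tangentBundle_mk_congr {p q : M} (h : p = q) {v : TangentSpace 𝓘(ℝ, B) p}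
    {w : TangentSpace 𝓘(ℝ, B) q} (hvw : (show B from v) = w) :
    (⟨p, v⟩ : TangentBundle 𝓘(ℝ, B) M) = ⟨q, w⟩ := by
  subst h
  exact congrArg _ hvw

end TangentMaps

/-! ### Coordinate frames of divided charts. -/

section ChartFrame

variable {n m : ℕ} {E : Type*} [TopologicalSpace E] [ChartedSpace (Model n m) E]

/-- The coordinate frame of a divided chart at `q`: it sends `c` to the tangent vector at `q` with
components `c`. -/
def chartFrame (φ : OpenPartialHomeomorph E (Model n m)) (q : E) :
    Model n m →L[ℝ] TangentSpace 𝓘(ℝ, Model n m) q := dChartSymm φ (φ q)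

theorem chartFrame_dChart {φ : OpenPartialHomeomorph E (Model n m)}
    (hφ : φ ∈ IsManifold.maximalAtlas 𝓘(ℝ, Model n m) ∞ E) {q : E} (hq : q ∈ φ.source)
    (v : TangentSpace 𝓘(ℝ, Model n m) q) : chartFrame φ q (dChart φ q v) = v :=
  dChartSymm_dChart hφ hq v

theorem dChart_chartFrame {φ : OpenPartialHomeomorph E (Model n m)}
    (hφ : φ ∈ IsManifold.maximalAtlas 𝓘(ℝ, Model n m) ∞ E) {q : E} (hq : q ∈ φ.source)
    (c : Model n m) : dChart φ q (chartFrame φ q c) = c := by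
  have := dChart_dChartSymm hφ (φ.map_source hq) c
  rw [φ.left_inv hq] at this
  exact this

variable [IsManifold 𝓘(ℝ, Model n m) ∞ E]
  {B N : Type*} [NormedAddCommGroup B] [NormedSpace ℝ B] [TopologicalSpace N] [ChartedSpace B N]

/-- The field is the tangent map of `φ.symm` applied to the pair `(φ ∘ g, h)`. Base point and
components both vary over `N`, which serves for fields on `E` and for sections over `J^1(E,n)`. -/
theorem contMDiffAt_chartFrame {φ : OpenPartialHomeomorph E (Model n m)}
    (hφ : φ ∈ IsManifold.maximalAtlas 𝓘(ℝ, Model n m) ∞ E) {g : N → E} {h : N → Model n m} {y : N}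
    (hg : ContMDiffAt 𝓘(ℝ, B) 𝓘(ℝ, Model n m) ∞ g y) (hy : g y ∈ φ.source)
    (hh : ContMDiffAt 𝓘(ℝ, B) 𝓘(ℝ, Model n m) ∞ h y) :
    ContMDiffAt 𝓘(ℝ, B) 𝓘(ℝ, Model n m).tangent ∞
      (fun z => (⟨g z, chartFrame φ (g z) (h z)⟩ : TangentBundle 𝓘(ℝ, Model n m) E)) y := by
  have h1 : ContMDiffAt 𝓘(ℝ, B) 𝓘(ℝ, Model n m).tangent ∞
      (fun z => (⟨φ (g z), h z⟩ : TangentBundle 𝓘(ℝ, Model n m) (Model n m))) y := by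
    rw [contMDiffAt_totalSpace]
    refine ⟨(contMDiffAt_of_mem_maximalAtlas hφ hy).comp y hg, ?_⟩
    simpa using hh
  have h2 := (contMDiffAt_tangentMap φ.open_target (contMDiffOn_symm_of_mem_maximalAtlas hφ)
    (w := ⟨φ (g y), h y⟩) (φ.map_source hy)).comp y h1
  refine h2.congr_of_eventuallyEq ?_
  filter_upwards [hg.continuousAt.eventually (φ.open_source.mem_nhds hy)] with z hz
  exact tangentBundle_mk_congr (φ.left_inv hz).symm rfl

theorem contMDiffAt_tangentMap_dChart {φ : OpenPartialHomeomorph E (Model n m)}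
    (hφ : φ ∈ IsManifold.maximalAtlas 𝓘(ℝ, Model n m) ∞ E) {w : TangentBundle 𝓘(ℝ, Model n m) E}
    (hw : w.proj ∈ φ.source) :
    ContMDiffAt 𝓘(ℝ, Model n m).tangent 𝓘(ℝ, Model n m) ∞
      (fun w' : TangentBundle 𝓘(ℝ, Model n m) E => dChart φ w'.proj w'.2) w :=
  (contMDiff_snd_tangentBundle_modelSpace (Model n m) 𝓘(ℝ, Model n m)).contMDiffAt.comp w
    (contMDiffAt_tangentMap φ.open_source (contMDiffOn_of_mem_maximalAtlas hφ) hw)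

theorem contMDiffAt_dChart {φ : OpenPartialHomeomorph E (Model n m)}
    (hφ : φ ∈ IsManifold.maximalAtlas 𝓘(ℝ, Model n m) ∞ E)
    {σ : ∀ q : E, TangentSpace 𝓘(ℝ, Model n m) q} {p : E} (hp : p ∈ φ.source)
    (hσ : ContMDiffAt 𝓘(ℝ, Model n m) 𝓘(ℝ, Model n m).tangent ∞
      (fun q => (⟨q, σ q⟩ : TangentBundle 𝓘(ℝ, Model n m) E)) p) :
    ContMDiffAt 𝓘(ℝ, Model n m) 𝓘(ℝ, Model n m) ∞ (fun q => dChart φ q (σ q)) p :=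
  ContMDiffAt.comp (g := fun w' : TangentBundle 𝓘(ℝ, Model n m) E => dChart φ w'.proj w'.2) p
    (contMDiffAt_tangentMap_dChart hφ (w := ⟨p, σ p⟩) hp) hσ

end ChartFrame

/-! ### Covariant derivatives in components, pull-backs and Christoffel forms. -/

section Covariant

variable {n m : ℕ} {E : Type*} [TopologicalSpace E] [ChartedSpace (Model n m) E]
  [IsManifold 𝓘(ℝ, Model n m) ∞ E]

/-- Differentiability at `p` of a vector field. -/
abbrev FieldMDiffAt (σ : ∀ q : E, TangentSpace 𝓘(ℝ, Model n m) q) (p : E) : Prop :=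
  MDifferentiableAt 𝓘(ℝ, Model n m) 𝓘(ℝ, Model n m).tangent
    (fun q => (⟨q, σ q⟩ : TangentBundle 𝓘(ℝ, Model n m) E)) p

omit [IsManifold 𝓘(ℝ, Model n m) ∞ E] in
theorem mvfderiv_congr {f g : E → Model n m} {p : E} (h : f =ᶠ[𝓝 p] g) :
    mvfderiv 𝓘(ℝ, Model n m) f p = mvfderiv 𝓘(ℝ, Model n m) g p :=
  h.mfderiv_eq

/-- The covariant derivative minus the derivative of the components depends only on the value of
the vector field. -/
theorem cov_sub_deriv_components (Γ : LinearConnection n m E) {p : E}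
    (D : ∀ q : E, TangentSpace 𝓘(ℝ, Model n m) q →L[ℝ] Model n m)
    (S : Model n m →L[ℝ] TangentSpace 𝓘(ℝ, Model n m) p) (hS : ∀ v, S (D p v) = v)
    (hD : ∀ σ, FieldMDiffAt σ p →
      MDifferentiableAt 𝓘(ℝ, Model n m) 𝓘(ℝ, Model n m) (fun q => D q (σ q)) p)
    {σ σ' : ∀ q : E, TangentSpace 𝓘(ℝ, Model n m) q} (hσ : FieldMDiffAt σ p)
    (hσ' : FieldMDiffAt σ' p) (h : σ p = σ' p) (X : TangentSpace 𝓘(ℝ, Model n m) p) :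
    Γ σ p X - S (mvfderiv 𝓘(ℝ, Model n m) (fun q => D q (σ q)) p X) =
    Γ σ' p X - S (mvfderiv 𝓘(ℝ, Model n m) (fun q => D q (σ' q)) p X) := by
  have hΓ := Γ.isCovariantDerivativeOnUniv
  have : IsManifold 𝓘(ℝ, Model n m) 1 E := .of_le (n := ∞) (by simp)
  have : IsManifold 𝓘(ℝ, Model n m) (1 + 1) E := .of_le (n := 2) one_add_one_eq_two.le
  -- Under `σ ↦ f • σ` both terms acquire the same extra summand `df(X) σ(p)`, because `S` undoes `D
  -- p`. The difference is therefore tensorial in `σ`.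
  refine TensorialAt.pointwise (I := 𝓘(ℝ, Model n m)) (F := Model n m)
    (Φ := fun σ : ∀ q : E, TangentSpace 𝓘(ℝ, Model n m) q => Γ σ p X -
      S (mvfderiv 𝓘(ℝ, Model n m) (fun q => D q (σ q)) p X))
    (x := p) ⟨?_, ?_⟩ hσ hσ' h
  · intro f σ hf hσ
    have h1 := congrArg (fun T => T X) (hΓ.leibniz hσ hf)
    have h2 : (fun q => D q ((f • σ) q)) = f • fun q => D q (σ q) := by
      ext1 q; exact map_smul (D q) (f q) (σ q)
    have h3 := congrArg (fun T => T X) (mvfderiv_smul hf (hD σ hσ))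
    simp only [h2]
    simp only [add_apply, smul_apply,
      ContinuousLinearMap.smulRight_apply] at h1 h3
    rw [h1, h3, map_add, map_smul, map_smul, hS]
    module
  · intro σ σ' hσ hσ'
    have h1 := congrArg (fun T => T X) (hΓ.add hσ hσ')
    have h2 : (fun q => D q ((σ + σ') q)) = (fun q => D q (σ q)) + fun q => D q (σ' q) := by
      ext1 q; exact map_add (D q) (σ q) (σ' q)
    have h3 := congrArg (fun T => T X) (mvfderiv_add (hD σ hσ) (hD σ' hσ'))
    simp only [h2]
    simp only [add_apply] at h1 h3
    rw [h1, h3, map_add]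
    module

variable (n m) in
/-- The standard trivialization of `TE` at `p`. -/
abbrev tangentTriv (p : E) : Trivialization (Model n m)
    (TotalSpace.proj : TangentBundle 𝓘(ℝ, Model n m) E → E) :=
  trivializationAt (Model n m) (fun p : E => TangentSpace 𝓘(ℝ, Model n m) p) p

/-- The vector field that has, in the standard trivialization at `p`, constant components `c`. -/
def trivField (p : E) (c : Model n m) (q : E) : TangentSpace 𝓘(ℝ, Model n m) q :=
  (tangentTriv n m p).symm q c

/-- Compare `σ` with the field having the same value at `p` and constant components, whose component
derivative vanishes. The right side has the shape of `verticalProj`. -/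
theorem cov_eq_trivField_add (Γ : LinearConnection n m E)
    {σ : ∀ q : E, TangentSpace 𝓘(ℝ, Model n m) q} {p : E} (hσ : FieldMDiffAt σ p)
    (X : TangentSpace 𝓘(ℝ, Model n m) p) :
    Γ σ p X = (tangentTriv n m p).symm p
        (mvfderiv 𝓘(ℝ, Model n m) (fun q => (tangentTriv n m p ⟨q, σ q⟩).2) p X) +
      Γ (trivField p (tangentTriv n m p ⟨p, σ p⟩).2) p X := by
  have : IsManifold 𝓘(ℝ, Model n m) 1 E := .of_le (n := ∞) (by simp)
  have hp : p ∈ (tangentTriv n m p).baseSet := FiberBundle.mem_baseSet_trivializationAt' p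
  have hnhds : (tangentTriv n m p).baseSet ∈ 𝓝 p := (tangentTriv n m p).open_baseSet.mem_nhds hp
  have hcomp (σ : ∀ q : E, TangentSpace 𝓘(ℝ, Model n m) q) :
      (fun q => (tangentTriv n m p).continuousLinearMapAt ℝ q (σ q)) =ᶠ[𝓝 p]
        fun q => (tangentTriv n m p ⟨q, σ q⟩).2 := by
    filter_upwards [hnhds] with q hq
    rw [Trivialization.continuousLinearMapAt_apply, Trivialization.linearMapAt_apply, if_pos hq]
  have hconst : (fun q => (tangentTriv n m p
      ⟨q, trivField p (tangentTriv n m p ⟨p, σ p⟩).2 q⟩).2) =ᶠ[𝓝 p]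
      fun _ => (tangentTriv n m p ⟨p, σ p⟩).2 := by
    filter_upwards [hnhds] with q hq
    rw [trivField, (tangentTriv n m p).apply_mk_symm hq]
  have hσ' : FieldMDiffAt (trivField p (tangentTriv n m p ⟨p, σ p⟩).2) p := by
    rw [FieldMDiffAt, mdifferentiableAt_totalSpace]
    exact ⟨mdifferentiableAt_id, mdifferentiableAt_const.congr_of_eventuallyEq hconst⟩
  have hval : σ p = trivField p (tangentTriv n m p ⟨p, σ p⟩).2 p :=
    ((tangentTriv n m p).symm_proj_apply ⟨p, σ p⟩ hp).symm
  have key := cov_sub_deriv_components Γ (fun q => (tangentTriv n m p).continuousLinearMapAt ℝ q)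
    ((tangentTriv n m p).symmL ℝ p)
    (fun v => (tangentTriv n m p).symmL_continuousLinearMapAt hp v)
    (fun σ hσ => ((mdifferentiableAt_totalSpace _ _).1 hσ).2.congr_of_eventuallyEq (hcomp σ))
    hσ hσ' hval X
  rw [mvfderiv_congr ((hcomp _).trans hconst), mvfderiv_congr (hcomp σ), mvfderiv_const] at key
  simp only [zero_apply, map_zero, sub_zero] at key
  rw [← key, Trivialization.symmL_apply _ hp]
  exact (add_sub_cancel _ (Γ σ p X)).symm

/-- The vertical part of the derivative of a vector field is its covariant derivative. -/
theorem verticalProj_mfderiv (Γ : LinearConnection n m E)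
    {σ : ∀ q : E, TangentSpace 𝓘(ℝ, Model n m) q} {p : E} (hσ : FieldMDiffAt σ p)
    (X : TangentSpace 𝓘(ℝ, Model n m) p) :
    verticalProj Γ ⟨p, σ p⟩ (mfderiv 𝓘(ℝ, Model n m) 𝓘(ℝ, Model n m).tangent
      (fun q => (⟨q, σ q⟩ : TangentBundle 𝓘(ℝ, Model n m) E)) p X) = Γ σ p X := by
  have : IsManifold 𝓘(ℝ, Model n m) 1 E := .of_le (n := ∞) (by simp)
  have hsrc : (⟨p, σ p⟩ : TangentBundle 𝓘(ℝ, Model n m) E) ∈ (tangentTriv n m p).source :=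
    (tangentTriv n m p).mem_source.2 (FiberBundle.mem_baseSet_trivializationAt' p)
  have hsnd : MDifferentiableAt 𝓘(ℝ, Model n m).tangent 𝓘(ℝ, Model n m)
      (fun w' : TangentBundle 𝓘(ℝ, Model n m) E => (tangentTriv n m p w').2) ⟨p, σ p⟩ :=
    ((Trivialization.mdifferentiableAt_totalSpace_iff (IM := 𝓘(ℝ, Model n m).tangent) (IB := 𝓘(ℝ, Model n m))
      (tangentTriv n m p) (fun w' => w') hsrc).1 mdifferentiableAt_id).2
  have hproj : MDifferentiableAt 𝓘(ℝ, Model n m).tangent 𝓘(ℝ, Model n m)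
      (fun w' : TangentBundle 𝓘(ℝ, Model n m) E => w'.proj) ⟨p, σ p⟩ :=
    mdifferentiableAt_proj _
  -- Chain rule for the fibre component and for the base projection; the latter composed with `σ` is
  -- the identity, so it returns `X`.
  have h1 := congrArg (fun T => T X) (mfderiv_comp p hsnd hσ)
  have h2 := congrArg (fun T => T X) (mfderiv_comp p hproj hσ)
  have h3 := congrArg (fun T => T X) (mfderiv_id (I := 𝓘(ℝ, Model n m)) (x := p))
  rw [cov_eq_trivField_add Γ hσ]
  exact congrArg₂ (· + ·) (congrArg ((tangentTriv n m p).symm p) h1.symm)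
    (congrArg (Γ (trivField p (tangentTriv n m p ⟨p, σ p⟩).2) p) (h2.symm.trans h3))

/-- If `τ` is a local right inverse of `f`, then the pull-back covariant derivative along a vector
tangent to the image of `τ` is the covariant derivative of the vector field obtained by restricting
the section to that image. -/
theorem pullbackCov_mfderiv (Γ : LinearConnection n m E) {B N : Type*} [NormedAddCommGroup B]
    [NormedSpace ℝ B] [TopologicalSpace N] [ChartedSpace B N] {f : N → E}
    {s : ∀ y, TangentSpace 𝓘(ℝ, Model n m) (f y)} {y : N}
    (hs : MDifferentiableAt 𝓘(ℝ, B) 𝓘(ℝ, Model n m).tangent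
      (fun y' => (⟨f y', s y'⟩ : TangentBundle 𝓘(ℝ, Model n m) E)) y)
    {τ : E → N} (hτ : MDifferentiableAt 𝓘(ℝ, Model n m) 𝓘(ℝ, B) τ (f y)) (hy : τ (f y) = y)
    (hf : ∀ᶠ q in 𝓝 (f y), f (τ q) = q) {σ : ∀ q : E, TangentSpace 𝓘(ℝ, Model n m) q}
    (hσ : ∀ q, σ q = (show Model n m from s (τ q))) (X : TangentSpace 𝓘(ℝ, Model n m) (f y)) :
    pullbackCov Γ f s y (mfderiv 𝓘(ℝ, Model n m) 𝓘(ℝ, B) τ (f y) X) = Γ σ (f y) X := by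
  have heq : (fun q => (⟨q, σ q⟩ : TangentBundle 𝓘(ℝ, Model n m) E)) =ᶠ[𝓝 (f y)]
      (fun y' => (⟨f y', s y'⟩ : TangentBundle 𝓘(ℝ, Model n m) E)) ∘ τ := by
    filter_upwards [hf] with q hq
    exact tangentBundle_mk_congr hq.symm (hσ q)
  have hmd : FieldMDiffAt σ (f y) :=
    (MDifferentiableAt.comp (f y) (hy.symm ▸ hs) hτ).congr_of_eventuallyEq heq
  have hv : s y = σ (f y) := by
    rw [hσ]
    exact congrArg (fun z => (show Model n m from s z)) hy.symm
  -- Chain rule for the section composed with `τ`. The differential is produced at `τ (f y)` and has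
  -- to be transported to `y`, which all tangent spaces being copies of the model space makes
  -- possible.
  have hd : mfderiv 𝓘(ℝ, Model n m) 𝓘(ℝ, Model n m).tangent
      (fun q => (⟨q, σ q⟩ : TangentBundle 𝓘(ℝ, Model n m) E)) (f y) X =
      mfderiv 𝓘(ℝ, B) 𝓘(ℝ, Model n m).tangent
        (fun y' => (⟨f y', s y'⟩ : TangentBundle 𝓘(ℝ, Model n m) E)) y
        (mfderiv 𝓘(ℝ, Model n m) 𝓘(ℝ, B) τ (f y) X) := by
    rw [heq.mfderiv_eq]
    refine (congrArg (fun T => T X) (mfderiv_comp_of_eq hs hτ hy)).trans ?_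
    exact congrArg (fun z => show Model n m × Model n m from
      mfderiv 𝓘(ℝ, B) 𝓘(ℝ, Model n m).tangent
        (fun y' => (⟨f y', s y'⟩ : TangentBundle 𝓘(ℝ, Model n m) E)) z
        (show B from mfderiv 𝓘(ℝ, Model n m) 𝓘(ℝ, B) τ (f y) X)) hy
  have := verticalProj_mfderiv Γ hmd X
  unfold pullbackCov
  rw [hv]
  refine Eq.trans ?_ this
  exact congrArg (verticalProj Γ ⟨f y, σ (f y)⟩) hd.symm

/-- The vector field with constant components `c` in the divided chart `φ`. -/
def coordField (φ : OpenPartialHomeomorph E (Model n m)) (c : Model n m) (q : E) :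
    TangentSpace 𝓘(ℝ, Model n m) q := chartFrame φ q c

theorem coordField_mdifferentiableAt {φ : OpenPartialHomeomorph E (Model n m)}
    (hφ : φ ∈ IsManifold.maximalAtlas 𝓘(ℝ, Model n m) ∞ E) {p : E} (hp : p ∈ φ.source)
    (c : Model n m) : FieldMDiffAt (coordField φ c) p :=
  (contMDiffAt_chartFrame hφ contMDiffAt_id hp contMDiffAt_const).mdifferentiableAt (by simp)

/-- The Christoffel form of `Γ` at `p` in the divided chart `φ`. -/
def christoffel (Γ : LinearConnection n m E) (φ : OpenPartialHomeomorph E (Model n m)) (p : E)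
    (a c : Model n m) : Model n m :=
  dChart φ p (Γ (coordField φ c) p (chartFrame φ p a))

/-- The covariant derivative in a divided chart. -/
theorem dChart_cov (Γ : LinearConnection n m E) {φ : OpenPartialHomeomorph E (Model n m)}
    (hφ : φ ∈ IsManifold.maximalAtlas 𝓘(ℝ, Model n m) ∞ E) {p : E} (hp : p ∈ φ.source)
    {Y : ∀ q : E, TangentSpace 𝓘(ℝ, Model n m) q} (hY : FieldMDiffAt Y p)
    (X : TangentSpace 𝓘(ℝ, Model n m) p) :
    dChart φ p (Γ Y p X) = mvfderiv 𝓘(ℝ, Model n m) (fun q => dChart φ q (Y q)) p X +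
      christoffel Γ φ p (dChart φ p X) (dChart φ p (Y p)) := by
  -- The comparison field has the value of `Y` at `p` and constant components in `φ`, so its
  -- covariant derivative is the Christoffel term alone.
  have hconst : (fun q => dChart φ q (coordField φ (dChart φ p (Y p)) q)) =ᶠ[𝓝 p]
      fun _ => dChart φ p (Y p) := by
    filter_upwards [φ.open_source.mem_nhds hp] with q hq
    exact dChart_chartFrame hφ hq _
  have key := cov_sub_deriv_components Γ (fun q => dChart φ q) (chartFrame φ p)
    (fun v => chartFrame_dChart hφ hp v) (fun σ hσ => MDifferentiableAt.comp
      (g := fun w' : TangentBundle 𝓘(ℝ, Model n m) E => dChart φ w'.proj w'.2) p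
      ((contMDiffAt_tangentMap_dChart hφ (w := ⟨p, σ p⟩) hp).mdifferentiableAt (by simp)) hσ)
    hY (coordField_mdifferentiableAt hφ hp (dChart φ p (Y p)))
    (chartFrame_dChart hφ hp (Y p)).symm X
  rw [mvfderiv_congr hconst, mvfderiv_const] at key
  simp only [zero_apply, map_zero, sub_zero] at key
  rw [christoffel, chartFrame_dChart hφ hp, ← key, map_sub, dChart_chartFrame hφ hp]
  simp

/-- In this slot linearity is that of `∇_X` in `X`. In the other slot it will come from symmetry. -/
theorem christoffel_add_left (Γ : LinearConnection n m E)
    (φ : OpenPartialHomeomorph E (Model n m)) (p : E) (a a' c : Model n m) :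
    christoffel Γ φ p (a + a') c = christoffel Γ φ p a c + christoffel Γ φ p a' c := by
  simp [christoffel]

theorem christoffel_smul_left (Γ : LinearConnection n m E)
    (φ : OpenPartialHomeomorph E (Model n m)) (p : E) (r : ℝ) (a c : Model n m) :
    christoffel Γ φ p (r • a) c = r • christoffel Γ φ p a c := by
  simp [christoffel]

/-- The constant vector field on the model space. -/
def constField (c : Model n m) (z : Model n m) : TangentSpace 𝓘(ℝ, Model n m) z := c

/-- The Christoffel form of a torsion-free connection is symmetric. -/
theorem christoffel_symm (Γ : LinearConnection n m E) (hΓ : Γ.torsion = 0)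
    {φ : OpenPartialHomeomorph E (Model n m)}
    (hφ : φ ∈ IsManifold.maximalAtlas 𝓘(ℝ, Model n m) ∞ E) {p : E} (hp : p ∈ φ.source)
    (a c : Model n m) : christoffel Γ φ p a c = christoffel Γ φ p c a := by
  -- Coordinate fields are pull-backs of constant fields, so their Lie bracket vanishes, and zero
  -- torsion then lets the two arguments be exchanged.
  have hmp (c : Model n m) : coordField φ c =ᶠ[𝓝 p]
      VectorField.mpullback 𝓘(ℝ, Model n m) 𝓘(ℝ, Model n m) φ (constField c) := by
    filter_upwards [φ.open_source.mem_nhds hp] with q hq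
    have : (dChart φ q).inverse = chartFrame φ q := ContinuousLinearMap.inverse_eq
      (ContinuousLinearMap.ext fun v => dChart_chartFrame hφ hq v)
      (ContinuousLinearMap.ext fun v => chartFrame_dChart hφ hq v)
    exact congrArg (fun T => T c) this.symm
  have hbr : VectorField.mlieBracket 𝓘(ℝ, Model n m) (coordField φ a) (coordField φ c) p = 0 := by
    have hcd (c : Model n m) : MDifferentiableAt 𝓘(ℝ, Model n m) 𝓘(ℝ, Model n m).tangent
        (fun z => (⟨z, constField c z⟩ : TangentBundle 𝓘(ℝ, Model n m) (Model n m))) (φ p) := by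
      rw [mdifferentiableAt_totalSpace]
      exact ⟨mdifferentiableAt_id, by simpa [constField] using mdifferentiableAt_const⟩
    have : IsManifold 𝓘(ℝ, Model n m) (minSmoothness ℝ 2) E :=
      .of_le (n := ∞) (by simpa using ENat.LEInfty.out)
    have : IsManifold 𝓘(ℝ, Model n m) (minSmoothness ℝ 3) E :=
      .of_le (n := ∞) (by simpa using ENat.LEInfty.out)
    rw [(hmp a).mlieBracket_vectorField_eq (hmp c), ← VectorField.mpullback_mlieBracket (n := ∞)
      (hcd a) (hcd c) (contMDiffAt_of_mem_maximalAtlas hφ hp)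
      (by simpa using ENat.LEInfty.out),
      VectorField.mpullback_apply]
    have h0 : VectorField.mlieBracket 𝓘(ℝ, Model n m) (constField a) (constField c) (φ p) = 0 := by
      rw [← VectorField.mlieBracketWithin_univ, VectorField.mlieBracketWithin_eq_lieBracketWithin]
      change fderivWithin ℝ (fun _ : Model n m => c) univ (φ p) a -
        fderivWithin ℝ (fun _ : Model n m => a) univ (φ p) c = 0
      simp
    exact (congrArg _ h0).trans (map_zero _)
  have h := CovariantDerivative.torsion_eq_zero_iff Γ |>.1 hΓ
    (coordField_mdifferentiableAt hφ hp a) (coordField_mdifferentiableAt hφ hp c)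
  rw [hbr, sub_eq_zero] at h
  exact congrArg (dChart φ p) h

end Covariant

/-! ### The second fundamental form of a graph. -/

section Graphs

variable {n m : ℕ} {E : Type*} [TopologicalSpace E] [ChartedSpace (Model n m) E]

/-- Lets statements about the tangent space at the base point be used at all nearby points of `L`,
as needed to differentiate along `L`. -/
theorem IsLocalGraph.eventually {L : Set E} {p : E} {φ : OpenPartialHomeomorph E (Model n m)}
    {f : EuclideanSpace ℝ (Fin n) → EuclideanSpace ℝ (Fin m)} (h : IsLocalGraph L p φ f) :
    ∀ᶠ q in 𝓝 p, IsLocalGraph L q φ f := by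
  have hc : Tendsto (fun q => (φ q).1) (𝓝 p) (𝓝 (φ p).1) :=
    (continuous_fst.tendsto _).comp (φ.continuousAt h.mem_source)
  filter_upwards [φ.open_source.mem_nhds h.mem_source,
    hc.eventually h.contDiffAt.eventually_nhds, h.mem_iff.eventually_nhds] with q h1 h2 h3
  exact ⟨h.mem_maximalAtlas, h1, h2, h3⟩

/-- The graph of a smooth map in a divided chart, as a submanifold. -/
def graphSubmanifold (φ : OpenPartialHomeomorph E (Model n m))
    (hφ : φ ∈ IsManifold.maximalAtlas 𝓘(ℝ, Model n m) ∞ E)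
    (f : EuclideanSpace ℝ (Fin n) → EuclideanSpace ℝ (Fin m)) (hf : ContDiff ℝ ∞ f) (p : E)
    (hp : p ∈ φ.source) (hpf : (φ p).2 = f (φ p).1) : PointedSubmanifold n m E where
  carrier := {q | q ∈ φ.source ∧ (φ q).2 = f (φ q).1}
  exists_graph q hq := ⟨φ, f, hφ, hq.1, .of_forall fun _ => hf.contDiffAt, by
    filter_upwards [φ.open_source.mem_nhds hq.1] with z hz
    exact and_iff_right hz⟩
  pt := p
  pt_mem := ⟨hp, hpf⟩

theorem isLocalGraph_graphSubmanifold {φ : OpenPartialHomeomorph E (Model n m)}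
    {hφ : φ ∈ IsManifold.maximalAtlas 𝓘(ℝ, Model n m) ∞ E}
    {f : EuclideanSpace ℝ (Fin n) → EuclideanSpace ℝ (Fin m)} {hf : ContDiff ℝ ∞ f} {p : E}
    {hp : p ∈ φ.source} {hpf : (φ p).2 = f (φ p).1} :
    IsLocalGraph (graphSubmanifold φ hφ f hf p hp hpf).carrier p φ f :=
  ⟨hφ, hp, .of_forall fun _ => hf.contDiffAt, by
    filter_upwards [φ.open_source.mem_nhds hp] with z hz
    exact and_iff_right hz⟩

theorem mem_tangentPlane_iff {L : Set E} {p : E} (hp : p ∈ L)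
    {φ : OpenPartialHomeomorph E (Model n m)}
    {f : EuclideanSpace ℝ (Fin n) → EuclideanSpace ℝ (Fin m)} (h : IsLocalGraph L p φ f)
    (v : TangentSpace 𝓘(ℝ, Model n m) p) : v ∈ tangentPlane (Model n m) L p ↔
      (dChart φ p v).2 = fderiv ℝ f (φ p).1 (dChart φ p v).1 := by
  have h1 := map_tangentPlane hp h
  have h2 : dChart φ p v ∈ (tangentPlane (Model n m) L p).map (dChart φ p).toLinearMap ↔
      v ∈ tangentPlane (Model n m) L p :=
    ⟨fun ⟨w, hw, e⟩ => dChart_injective h.mem_maximalAtlas h.mem_source e ▸ hw,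
      Submodule.mem_map_of_mem⟩
  rw [← h2, h1]
  exact LinearMap.mem_graph_iff _ _

theorem hasSlope_jet1 {P : PointedSubmanifold n m E} {φ : OpenPartialHomeomorph E (Model n m)}
    {f : EuclideanSpace ℝ (Fin n) → EuclideanSpace ℝ (Fin m)}
    (h : IsLocalGraph P.carrier P.pt φ f) : HasSlope φ P.jet1 (fderiv ℝ f (φ P.pt).1) :=
  map_tangentPlane P.pt_mem h

variable [IsManifold 𝓘(ℝ, Model n m) ∞ E]

/-- The part `ω ∘ Γ` of the second fundamental form, in a divided chart and on a plane of
slope `A`. -/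
def slopeForm (Γ : LinearConnection n m E) (φ : OpenPartialHomeomorph E (Model n m)) (p : E)
    (A : EuclideanSpace ℝ (Fin n) →L[ℝ] EuclideanSpace ℝ (Fin m)) (a b : EuclideanSpace ℝ (Fin n)) :
    EuclideanSpace ℝ (Fin m) :=
  (christoffel Γ φ p (a, A a) (b, A b)).2 - A (christoffel Γ φ p (a, A a) (b, A b)).1

/-- The derivative of the components of a tangent vector field along a graph. -/
theorem snd_mvfderiv_dChart {P : PointedSubmanifold n m E}
    {φ : OpenPartialHomeomorph E (Model n m)}
    {f : EuclideanSpace ℝ (Fin n) → EuclideanSpace ℝ (Fin m)}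
    (h : IsLocalGraph P.carrier P.pt φ f) {Y : ∀ q : E, TangentSpace 𝓘(ℝ, Model n m) q}
    (hY : P.IsTangentField Y) {X : TangentSpace 𝓘(ℝ, Model n m) P.pt}
    (hX : X ∈ tangentPlane (Model n m) P.carrier P.pt) :
    (mvfderiv 𝓘(ℝ, Model n m) (fun q => dChart φ q (Y q)) P.pt X).2 =
      fderiv ℝ (fderiv ℝ f) (φ P.pt).1 (dChart φ P.pt X).1 (dChart φ P.pt (Y P.pt)).1 +
      fderiv ℝ f (φ P.pt).1 (mvfderiv 𝓘(ℝ, Model n m) (fun q => dChart φ q (Y q)) P.pt X).1 := by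
  obtain ⟨L, hL, p, hp⟩ := P
  have hφ := h.mem_maximalAtlas
  have hps := h.mem_source
  have hpt : (φ p).2 = f (φ p).1 := h.mem_iff.self_of_nhds.1 hp
  have hXg := (mem_tangentPlane_iff hp h X).1 hX
  change p ∈ φ.source at hps
  change X ∈ tangentPlane (Model n m) L p at hX
  dsimp only at *
  have hy : MDifferentiableAt 𝓘(ℝ, Model n m) 𝓘(ℝ, Model n m) (fun q => dChart φ q (Y q)) p :=
    (contMDiffAt_dChart hφ hps hY.contMDiffAt).mdifferentiableAt (by simp)
  let y : E → Model n m := fun q => dChart φ q (Y q)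
  -- `φ.symm ∘ c` parametrizes `L` near `p`, which turns differentiation along `L` into ordinary
  -- calculus on `ℝⁿ`.
  let c : EuclideanSpace ℝ (Fin n) → Model n m := fun u => (u, f u)
  have hc0 : c (φ p).1 = φ p := Prod.ext rfl hpt.symm
  have hf : ContDiffAt ℝ ∞ f (φ p).1 := h.contDiffAt.self_of_nhds
  have hc : HasFDerivAt c ((ContinuousLinearMap.id ℝ _).prod (fderiv ℝ f (φ p).1)) (φ p).1 :=
    (hasFDerivAt_id _).prodMk (hf.differentiableAt (by simp)).hasFDerivAt
  have hsymm : HasMFDerivAt 𝓘(ℝ, Model n m) 𝓘(ℝ, Model n m) φ.symm (φ p)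
      (dChartSymm φ (φ p)) := (mdiff_symm_of_mem hφ (φ.map_source hps)).hasMFDerivAt
  have hyc : HasFDerivAt (fun u => y (φ.symm (c u)))
      (((mvfderiv 𝓘(ℝ, Model n m) y p).comp (chartFrame φ p)).comp
        ((ContinuousLinearMap.id ℝ _).prod (fderiv ℝ f (φ p).1))) (φ p).1 := by
    have h1 : HasMFDerivAt 𝓘(ℝ, Model n m) 𝓘(ℝ, Model n m) y (φ.symm (φ p))
      (mvfderiv 𝓘(ℝ, Model n m) y p) := by
      rw [φ.left_inv hps]; exact hy.hasMFDerivAt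
    have h2 : HasFDerivAt (y ∘ φ.symm) ((mvfderiv 𝓘(ℝ, Model n m) y p).comp (chartFrame φ p))
        (φ p) := hasMFDerivAt_iff_hasFDerivAt.1 (h1.comp (φ p) hsymm)
    rw [← hc0] at h2
    exact h2.comp (φ p).1 hc
  -- Tangency of `Y` at all points of `L` near `p`, in components. Differentiating the right side by
  -- the product rule produces the Hessian term.
  have hev : (fun u => (y (φ.symm (c u))).2) =ᶠ[𝓝 (φ p).1]
      fun u => fderiv ℝ f u (y (φ.symm (c u))).1 := by
    have hcc : Tendsto c (𝓝 (φ p).1) (𝓝 (φ p)) := by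
      simpa [hc0] using hc.continuousAt.tendsto
    have hcs : Tendsto (fun u => φ.symm (c u)) (𝓝 (φ p).1) (𝓝 p) := by
      have := (φ.continuousAt_symm (φ.map_source hps)).tendsto.comp hcc
      rwa [φ.left_inv hps] at this
    filter_upwards [hcs.eventually h.eventually, hcs.eventually h.mem_iff,
      hcs.eventually hY.tangent, hcc.eventually (φ.open_target.mem_nhds (φ.map_source hps))]
      with u h1 h2 h3 h4
    have h5 : φ.symm (c u) ∈ L := h2.2 (by rw [φ.right_inv h4])
    have h6 := (mem_tangentPlane_iff h5 h1 _).1 (h3 h5)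
    rw [φ.right_inv h4] at h6
    exact h6
  have hD : HasFDerivAt (fderiv ℝ f) (fderiv ℝ (fderiv ℝ f) (φ p).1) (φ p).1 :=
    ((hf.fderiv_right (m := 1) (one_add_one_eq_two.le.trans ENat.LEInfty.out)).differentiableAt (by simp)).hasFDerivAt
  have hr := (hD.clm_apply hyc.fst).congr_of_eventuallyEq hev
  have huniq := congrArg (fun T => T (dChart φ p X).1) (hyc.snd.unique hr)
  have hXp : chartFrame φ p ((dChart φ p X).1, fderiv ℝ f (φ p).1 (dChart φ p X).1) = X := by
    rw [← hXg]; exact chartFrame_dChart hφ hps X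
  have hyp : y (φ.symm (c (φ p).1)) = dChart φ p (Y p) := by rw [hc0, φ.left_inv hps]
  simp [hXp, hyp] at huniq
  rw [add_comm]
  exact huniq

/-- Modulo the plane of slope `A`, a vector with components `(v₁, v₂)` is measured by `v₂ - A v₁`.
In this combination the first derivatives of `Y` cancel, leaving an expression in the values of `X`
and `Y` at `p` only. -/
theorem secondFundamentalForm_eq_zero_iff (Γ : LinearConnection n m E)
    {P : PointedSubmanifold n m E} {φ : OpenPartialHomeomorph E (Model n m)}
    {f : EuclideanSpace ℝ (Fin n) → EuclideanSpace ℝ (Fin m)}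
    (h : IsLocalGraph P.carrier P.pt φ f) {Y : ∀ q : E, TangentSpace 𝓘(ℝ, Model n m) q}
    (hY : P.IsTangentField Y) (X : tangentPlane (Model n m) P.carrier P.pt) :
    secondFundamentalForm Γ P X Y = 0 ↔
      fderiv ℝ (fderiv ℝ f) (φ P.pt).1 (dChart φ P.pt X).1 (dChart φ P.pt (Y P.pt)).1 +
      slopeForm Γ φ P.pt (fderiv ℝ f (φ P.pt).1) (dChart φ P.pt X).1
        (dChart φ P.pt (Y P.pt)).1 = 0 := by
  have hmd : FieldMDiffAt Y P.pt := hY.contMDiffAt.mdifferentiableAt (by simp)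
  have hX : ((dChart φ P.pt X).1, fderiv ℝ f (φ P.pt).1 (dChart φ P.pt X).1) = dChart φ P.pt X := by
    rw [← (mem_tangentPlane_iff P.pt_mem h X).1 X.2]
  have hYp : ((dChart φ P.pt (Y P.pt)).1, fderiv ℝ f (φ P.pt).1 (dChart φ P.pt (Y P.pt)).1) =
      dChart φ P.pt (Y P.pt) := by
    rw [← (mem_tangentPlane_iff P.pt_mem h _).1 (hY.tangent.self_of_nhds P.pt_mem)]
  rw [secondFundamentalForm, Submodule.mkQ_apply, Submodule.Quotient.mk_eq_zero,
    mem_tangentPlane_iff P.pt_mem h, dChart_cov Γ h.mem_maximalAtlas h.mem_source hmd,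
    slopeForm, hX, hYp, Prod.snd_add, Prod.fst_add, snd_mvfderiv_dChart h hY X.2, map_add,
    ← sub_eq_zero]
  refine Eq.congr ?_ rfl
  abel

/-- The vector field with components `(b, Df(b))` in the divided chart `φ`; it is tangent to the
graph of `f`. -/
theorem isTangentField_chartFrame {P : PointedSubmanifold n m E}
    {φ : OpenPartialHomeomorph E (Model n m)}
    {f : EuclideanSpace ℝ (Fin n) → EuclideanSpace ℝ (Fin m)}
    (h : IsLocalGraph P.carrier P.pt φ f) (b : EuclideanSpace ℝ (Fin n)) :
    P.IsTangentField fun q => chartFrame φ q (b, fderiv ℝ f (φ q).1 b) := by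
  have hφ := h.mem_maximalAtlas
  refine ⟨contMDiffAt_chartFrame hφ contMDiffAt_id h.mem_source ?_, ?_⟩
  · have h1 : ContDiffAt ℝ ∞ (fun z : Model n m => ((b, fderiv ℝ f z.1 b) : Model n m)) (φ P.pt) := by
      refine contDiffAt_const.prodMk (ContDiffAt.clm_apply ?_ contDiffAt_const)
      exact ContDiffAt.comp (φ P.pt) (h.contDiffAt.self_of_nhds.fderiv_right (m := ∞) (by simp))
        contDiffAt_fst
    exact h1.contMDiffAt.comp P.pt (contMDiffAt_of_mem_maximalAtlas hφ h.mem_source)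
  · filter_upwards [h.eventually] with q hq hqL
    rw [mem_tangentPlane_iff hqL hq, dChart_chartFrame hφ hq.mem_source]

/-- The second fundamental form of the submanifold vanishes at its base point. -/
def IsTotallyGeodesicAt (Γ : LinearConnection n m E) (P : PointedSubmanifold n m E) : Prop :=
  ∀ X Y, P.IsTangentField Y → secondFundamentalForm Γ P X Y = 0

/-- The equation of totally geodesic submanifolds in a divided chart. -/
theorem isTotallyGeodesicAt_iff (Γ : LinearConnection n m E)
    {P : PointedSubmanifold n m E} {φ : OpenPartialHomeomorph E (Model n m)}
    {f : EuclideanSpace ℝ (Fin n) → EuclideanSpace ℝ (Fin m)}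
    (h : IsLocalGraph P.carrier P.pt φ f) : IsTotallyGeodesicAt Γ P ↔
      ∀ a b, fderiv ℝ (fderiv ℝ f) (φ P.pt).1 a b +
        slopeForm Γ φ P.pt (fderiv ℝ f (φ P.pt).1) a b = 0 := by
  refine ⟨fun hP a b => ?_, fun hP X Y hY =>
    (secondFundamentalForm_eq_zero_iff Γ h hY X).2 (hP _ _)⟩
  -- These fields realize every tangent vector at the base point, so the hypothesis can be tested on
  -- every pair `(a, b)`.
  have hY := isTangentField_chartFrame h b
  have hX : chartFrame φ P.pt (a, fderiv ℝ f (φ P.pt).1 a) ∈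
      tangentPlane (Model n m) P.carrier P.pt := by
    rw [mem_tangentPlane_iff P.pt_mem h, dChart_chartFrame h.mem_maximalAtlas h.mem_source]
  simpa [dChart_chartFrame h.mem_maximalAtlas h.mem_source] using
    (secondFundamentalForm_eq_zero_iff Γ h hY ⟨_, hX⟩).1 (hP ⟨_, hX⟩ _ hY)

end Graphs

/-! ### Differentials on tangent spaces of subsets. -/

section TangentPlanes

variable {B M B' N : Type*} [NormedAddCommGroup B] [NormedSpace ℝ B] [TopologicalSpace M]
  [ChartedSpace B M] [NormedAddCommGroup B'] [NormedSpace ℝ B'] [TopologicalSpace N]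
  [ChartedSpace B' N]

/-- If `τ ∘ g` is the identity on `S`, its differential is the identity on the tangent space
of `S`. -/
theorem mfderiv_mfderiv_of_mem_tangentPlane {S : Set N} {y : N} {g : N → M} {τ : M → N}
    (hg : MDifferentiableAt 𝓘(ℝ, B') 𝓘(ℝ, B) g y)
    (hτ : MDifferentiableAt 𝓘(ℝ, B) 𝓘(ℝ, B') τ (g y))
    (h : ∀ᶠ z in 𝓝 y, z ∈ S → τ (g z) = z) {v : TangentSpace 𝓘(ℝ, B') y}
    (hv : v ∈ tangentPlane B' S y) :
    (show B' from mfderiv 𝓘(ℝ, B) 𝓘(ℝ, B') τ (g y) (mfderiv 𝓘(ℝ, B') 𝓘(ℝ, B) g y v)) = v := by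
  -- The vectors fixed by the composite differential form a subspace, so it is enough to check
  -- velocities of curves in `S`.
  suffices tangentPlane B' S y ≤ LinearMap.eqLocus
      (((mfderiv 𝓘(ℝ, B) 𝓘(ℝ, B') τ (g y)).toLinearMap.comp
        (mfderiv 𝓘(ℝ, B') 𝓘(ℝ, B) g y).toLinearMap : B' →ₗ[ℝ] B'))
      (LinearMap.id : B' →ₗ[ℝ] B') from this hv
  refine Submodule.span_le.2 ?_
  rintro _ ⟨γ, hγ, rfl, hS, rfl⟩
  have hγ' := (hγ.mdifferentiableAt (by simp)).hasMFDerivAt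
  have h1 := hτ.hasMFDerivAt.comp (0 : ℝ) (hg.hasMFDerivAt.comp (0 : ℝ) hγ')
  have h2 : γ =ᶠ[𝓝 (0 : ℝ)] τ ∘ (g ∘ γ) := by
    filter_upwards [hS, hγ.continuousAt.eventually h] with t h3 h4 using (h4 h3).symm
  exact congrArg (fun T => T (1 : ℝ)) (hasMFDerivAt_unique (h1.congr_of_eventuallyEq h2) hγ')

/-- Curves in `L` go to curves in `S`. The base point `y` is kept separate from `τ p` so that the
result can be stated at `P.jet1`. -/
theorem mfderiv_mem_tangentPlane {L : Set M} {p : M} {S : Set N} {y : N} {τ : M → N}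
    (hτ : ContMDiffAt 𝓘(ℝ, B) 𝓘(ℝ, B') ∞ τ p) (hy : τ p = y) (h : ∀ᶠ q in 𝓝 p, q ∈ L → τ q ∈ S)
    {w : TangentSpace 𝓘(ℝ, B) p} (hw : w ∈ tangentPlane B L p) :
    (show TangentSpace 𝓘(ℝ, B') y from (show B' from mfderiv 𝓘(ℝ, B) 𝓘(ℝ, B') τ p w)) ∈
      tangentPlane B' S y := by
  subst hy
  suffices tangentPlane B L p ≤
      (tangentPlane B' S (τ p)).comap (mfderiv 𝓘(ℝ, B) 𝓘(ℝ, B') τ p).toLinearMap from this hw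
  refine Submodule.span_le.2 ?_
  rintro _ ⟨γ, hγ, rfl, hL, rfl⟩
  refine Submodule.subset_span ⟨τ ∘ γ, hτ.comp (0 : ℝ) hγ, rfl, ?_, ?_⟩
  · filter_upwards [hL, hγ.continuousAt.eventually h] with t h3 h4 using h4 h3
  · have := mfderiv_comp (0 : ℝ) (hτ.mdifferentiableAt (by simp)) (hγ.mdifferentiableAt (by simp))
    exact congrArg (fun T => T (1 : ℝ)) this

end TangentPlanes

/-! ### Smooth maps to and from the Grassmann bundle, and prolongations. -/

section GrassmannBundleMaps

variable {n m : ℕ} {E : Type*} [TopologicalSpace E] [ChartedSpace (Model n m) E]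
  [IsManifold 𝓘(ℝ, Model n m) ∞ E]

/-- The chart of `J^1(E,n)` induced by a divided chart, as an open partial homeomorphism. -/
def grassmannHomeomorph (φ : OpenPartialHomeomorph E (Model n m))
    (hφ : φ ∈ IsManifold.maximalAtlas 𝓘(ℝ, Model n m) ∞ E) :
    OpenPartialHomeomorph (GrassmannBundle n m E) (GrassmannModel n m) :=
  grassmannCore.openPartialHomeomorph (grassmannChart φ hφ) ⟨φ, hφ, rfl⟩

theorem grassmannHomeomorph_mem (φ : OpenPartialHomeomorph E (Model n m))
    (hφ : φ ∈ IsManifold.maximalAtlas 𝓘(ℝ, Model n m) ∞ E) :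
    grassmannHomeomorph φ hφ ∈
      IsManifold.maximalAtlas 𝓘(ℝ, GrassmannModel n m) ∞ (GrassmannBundle n m E) := by
  refine IsManifold.subset_maximalAtlas ?_
  exact mem_iUnion.2 ⟨grassmannChart φ hφ, mem_iUnion.2 ⟨⟨φ, hφ, rfl⟩, rfl⟩⟩

variable {φ : OpenPartialHomeomorph E (Model n m)}

/-- Concordance is an open condition: it cuts out the domain of the induced chart. -/
theorem eventually_concordant (hφ : φ ∈ IsManifold.maximalAtlas 𝓘(ℝ, Model n m) ∞ E)
    {θ : GrassmannBundle n m E} (hθ : θ.pt ∈ φ.source) (hs : ∃ A, HasSlope φ θ A) :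
    ∀ᶠ θ' in 𝓝 θ, θ'.pt ∈ φ.source ∧ ∃ A, HasSlope φ θ' A :=
  (grassmannHomeomorph φ hφ).open_source.mem_nhds ⟨hθ, hs⟩

theorem contMDiffAt_coords (hφ : φ ∈ IsManifold.maximalAtlas 𝓘(ℝ, Model n m) ∞ E)
    {θ : GrassmannBundle n m E} (hθ : θ.pt ∈ φ.source) (hs : ∃ A, HasSlope φ θ A) :
    ContMDiffAt 𝓘(ℝ, GrassmannModel n m) 𝓘(ℝ, GrassmannModel n m) ∞
      (fun θ' => (φ θ'.pt, slope φ θ')) θ :=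
  contMDiffAt_of_mem_maximalAtlas (grassmannHomeomorph_mem φ hφ) (x := θ) ⟨hθ, hs⟩

theorem contMDiffAt_planeOfSlope (hφ : φ ∈ IsManifold.maximalAtlas 𝓘(ℝ, Model n m) ∞ E)
    {z : GrassmannModel n m} (hz : z.1 ∈ φ.target) :
    ContMDiffAt 𝓘(ℝ, GrassmannModel n m) 𝓘(ℝ, GrassmannModel n m) ∞ (planeOfSlope φ hφ) z :=
  contMDiffAt_symm_of_mem_maximalAtlas (grassmannHomeomorph_mem φ hφ) hz

theorem contMDiffAt_slope (hφ : φ ∈ IsManifold.maximalAtlas 𝓘(ℝ, Model n m) ∞ E)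
    {θ : GrassmannBundle n m E} (hθ : θ.pt ∈ φ.source) (hs : ∃ A, HasSlope φ θ A) :
    ContMDiffAt 𝓘(ℝ, GrassmannModel n m)
      𝓘(ℝ, EuclideanSpace ℝ (Fin n) →L[ℝ] EuclideanSpace ℝ (Fin m)) ∞ (slope φ) θ :=
  contDiff_snd.contMDiff.contMDiffAt.comp θ (contMDiffAt_coords hφ hθ hs)

theorem contMDiff_pt : ContMDiff 𝓘(ℝ, GrassmannModel n m) 𝓘(ℝ, Model n m) ∞
    (GrassmannBundle.pt (n := n) (m := m) (E := E)) := by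
  intro θ
  obtain ⟨φ, hφ, hθ, hs⟩ := exists_dividedChart θ
  have h1 : ContMDiffAt 𝓘(ℝ, GrassmannModel n m) 𝓘(ℝ, Model n m) ∞
      (fun θ' : GrassmannBundle n m E => φ θ'.pt) θ :=
    contDiff_fst.contMDiff.contMDiffAt.comp θ (contMDiffAt_coords hφ hθ hs)
  have h2 := (contMDiffAt_symm_of_mem_maximalAtlas hφ (φ.map_source hθ)).comp θ h1
  refine h2.congr_of_eventuallyEq ?_
  filter_upwards [eventually_concordant hφ hθ hs] with θ' hθ'
  exact (φ.left_inv hθ'.1).symm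

open Classical in
/-- The section of the tautological bundle with components `(b, A b)`, where `A` is the slope, on
the planes to which `φ` is concordant. -/
def tautField (φ : OpenPartialHomeomorph E (Model n m)) (b : EuclideanSpace ℝ (Fin n))
    (θ : GrassmannBundle n m E) : TangentSpace 𝓘(ℝ, Model n m) θ.pt :=
  -- A tautological section must lie in every plane, but be smooth only at one; the value `0`
  -- satisfies the first demand where `φ` gives no slope.
  if θ.pt ∈ φ.source ∧ ∃ A, HasSlope φ θ A then chartFrame φ θ.pt (b, slope φ θ b) else 0

/-- Supplies enough test sections: as `b` varies, their values at `θ` fill the plane `θ`. -/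
theorem isTautologicalSectionAt_tautField
    (hφ : φ ∈ IsManifold.maximalAtlas 𝓘(ℝ, Model n m) ∞ E)
    {θ : GrassmannBundle n m E} (hθ : θ.pt ∈ φ.source) (hs : ∃ A, HasSlope φ θ A)
    (b : EuclideanSpace ℝ (Fin n)) : IsTautologicalSectionAt (tautField φ b) θ := by
  constructor
  · intro θ'
    by_cases h : θ'.pt ∈ φ.source ∧ ∃ A, HasSlope φ θ' A
    · rw [tautField, if_pos h]
      have h1 : ((b, slope φ θ' b) : Model n m) ∈ (slope φ θ').toLinearMap.graph := by simp
      rw [← hasSlope_slope h.2] at h1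
      obtain ⟨v, hv, e⟩ := h1
      have e' : dChart φ θ'.pt v = (b, slope φ θ' b) := e
      rw [← e', chartFrame_dChart hφ h.1]
      exact hv
    · rw [tautField, if_neg h]; exact zero_mem _
  · have h1 : ContMDiffAt 𝓘(ℝ, GrassmannModel n m) 𝓘(ℝ, Model n m) ∞
        (fun θ' => ((b, slope φ θ' b) : Model n m)) θ := by
      have h2 : ContDiff ℝ ∞ (fun A : EuclideanSpace ℝ (Fin n) →L[ℝ] EuclideanSpace ℝ (Fin m) =>
          ((b, A b) : Model n m)) := by fun_prop
      exact h2.contMDiff.contMDiffAt.comp θ (contMDiffAt_slope hφ hθ hs)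
    refine (contMDiffAt_chartFrame hφ contMDiff_pt.contMDiffAt hθ h1).congr_of_eventuallyEq ?_
    filter_upwards [eventually_concordant hφ hθ hs] with θ' hθ'
    rw [tautField, if_pos hθ']

/-- The first prolongation of the graph of `f`, as a map on `E`: it sends `q` to the plane at `q`
whose slope is the derivative of `f`. -/
def prolongMap (φ : OpenPartialHomeomorph E (Model n m))
    (hφ : φ ∈ IsManifold.maximalAtlas 𝓘(ℝ, Model n m) ∞ E)
    (f : EuclideanSpace ℝ (Fin n) → EuclideanSpace ℝ (Fin m)) (q : E) : GrassmannBundle n m E :=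
  planeOfSlope φ hφ (φ q, fderiv ℝ f (φ q).1)

variable {f : EuclideanSpace ℝ (Fin n) → EuclideanSpace ℝ (Fin m)}

-- `prolongMap` is thus a section of `π_{1,0}` over an open subset of `E`, not only over `L`, so
-- that ordinary differentials and the chain rule apply to it.
omit [IsManifold 𝓘(ℝ, Model n m) ∞ E] in
theorem pt_prolongMap (hφ : φ ∈ IsManifold.maximalAtlas 𝓘(ℝ, Model n m) ∞ E) {q : E}
    (hq : q ∈ φ.source) : (prolongMap φ hφ f q).pt = q := by
  rw [prolongMap, planeOfSlope_of_mem hφ (φ.map_source hq)]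
  exact φ.left_inv hq

theorem contMDiffAt_prolongMap {L : Set E} {p : E} (h : IsLocalGraph L p φ f) :
    ContMDiffAt 𝓘(ℝ, Model n m) 𝓘(ℝ, GrassmannModel n m) ∞
      (prolongMap φ h.mem_maximalAtlas f) p := by
  have hφ := h.mem_maximalAtlas
  have h1 : ContDiffAt ℝ ∞ (fun z : Model n m => ((z, fderiv ℝ f z.1) : GrassmannModel n m))
      (φ p) := contDiffAt_id.prodMk (ContDiffAt.comp (φ p)
        (h.contDiffAt.self_of_nhds.fderiv_right (m := ∞) (by simp)) contDiffAt_fst)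
  exact ContMDiffAt.comp p (contMDiffAt_planeOfSlope hφ (φ.map_source h.mem_source))
    (h1.contMDiffAt.comp p (contMDiffAt_of_mem_maximalAtlas hφ h.mem_source))

-- On `L^{(1)}` the composite of `π_{1,0}` and `prolongMap` is the identity, because both planes
-- have slope `Df`.
omit [IsManifold 𝓘(ℝ, Model n m) ∞ E] in
theorem prolongMap_eq {L : Set E} {θ : GrassmannBundle n m E} (h : IsLocalGraph L θ.pt φ f)
    (hL : θ.pt ∈ L) (hθ : θ.plane = tangentPlane (Model n m) L θ.pt) :
    prolongMap φ h.mem_maximalAtlas f θ.pt = θ := by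
  have hpt := pt_prolongMap (f := f) h.mem_maximalAtlas h.mem_source
  refine GrassmannBundle.eq_of_hasSlope h.mem_maximalAtlas (hpt.symm ▸ h.mem_source) hpt
    (hasSlope_planeOfSlope _ (φ.map_source h.mem_source)) ?_
  rw [HasSlope, hθ]
  exact map_tangentPlane hL h

omit [IsManifold 𝓘(ℝ, Model n m) ∞ E] in
theorem plane_prolongMap {L : Set E} {q : E} (h : IsLocalGraph L q φ f) (hL : q ∈ L) :
    (prolongMap φ h.mem_maximalAtlas f q).plane =
      tangentPlane (Model n m) L (prolongMap φ h.mem_maximalAtlas f q).pt := by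
  have hpl : Module.finrank ℝ (tangentPlane (Model n m) L q) = n := by
    rw [LinearEquiv.finrank_eq (Submodule.equivMapOfInjective
      (dChart φ q).toLinearMap (dChart_injective h.mem_maximalAtlas h.mem_source)
      (tangentPlane (Model n m) L q)), map_tangentPlane hL h, finrank_graph,
      finrank_euclideanSpace_fin]
  rw [prolongMap_eq (θ := ⟨q, _, hpl⟩) h hL rfl]

omit [IsManifold 𝓘(ℝ, Model n m) ∞ E] in
theorem prolongMap_mem_prolongation {P : PointedSubmanifold n m E} {q : E}
    (h : IsLocalGraph P.carrier q φ f) (hL : q ∈ P.carrier) :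
    prolongMap φ h.mem_maximalAtlas f q ∈ P.prolongation :=
  ⟨(pt_prolongMap h.mem_maximalAtlas h.mem_source).symm ▸ hL, plane_prolongMap h hL⟩

end GrassmannBundleMaps

/-! ### The `R`-plane and horizontality. -/

section HorizontalLifts

variable {n m : ℕ} {E : Type*} [TopologicalSpace E] [ChartedSpace (Model n m) E]
  [IsManifold 𝓘(ℝ, Model n m) ∞ E] {φ : OpenPartialHomeomorph E (Model n m)}
  {f : EuclideanSpace ℝ (Fin n) → EuclideanSpace ℝ (Fin m)} {P : PointedSubmanifold n m E}

/-- The image of `w` under the differential of the first prolongation. -/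
def prolongVector (h : IsLocalGraph P.carrier P.pt φ f) (w : TangentSpace 𝓘(ℝ, Model n m) P.pt) :
    TangentSpace 𝓘(ℝ, GrassmannModel n m) P.jet1 :=
  show GrassmannModel n m from mfderiv 𝓘(ℝ, Model n m) 𝓘(ℝ, GrassmannModel n m)
    (prolongMap φ h.mem_maximalAtlas f) P.pt w

omit [IsManifold 𝓘(ℝ, Model n m) ∞ E] in
theorem prolongMap_pt (h : IsLocalGraph P.carrier P.pt φ f) :
    prolongMap φ h.mem_maximalAtlas f P.pt = P.jet1 :=
  prolongMap_eq (θ := P.jet1) h P.pt_mem rfl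

omit [IsManifold 𝓘(ℝ, Model n m) ∞ E] in
theorem eventually_pt_prolongMap (h : IsLocalGraph P.carrier P.pt φ f) :
    ∀ᶠ q in 𝓝 P.pt, (prolongMap φ h.mem_maximalAtlas f q).pt = q := by
  filter_upwards [φ.open_source.mem_nhds h.mem_source] with q hq
  exact pt_prolongMap h.mem_maximalAtlas hq

theorem prolongVector_mem_rPlane (h : IsLocalGraph P.carrier P.pt φ f)
    {w : TangentSpace 𝓘(ℝ, Model n m) P.pt} (hw : w ∈ P.jet1.plane) :
    prolongVector h w ∈ P.rPlane := by
  refine mfderiv_mem_tangentPlane (contMDiffAt_prolongMap h) (prolongMap_pt h) ?_ hw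
  filter_upwards [h.eventually] with q hq hqL
  exact prolongMap_mem_prolongation hq hqL

/-- Differentiate `π_{1,0} ∘ prolongMap = id`. -/
theorem mfderiv_pt_prolongVector (h : IsLocalGraph P.carrier P.pt φ f)
    (w : TangentSpace 𝓘(ℝ, Model n m) P.pt) :
    mfderiv 𝓘(ℝ, GrassmannModel n m) 𝓘(ℝ, Model n m) GrassmannBundle.pt P.jet1
      (prolongVector h w) = w := by
  have hτ := (contMDiffAt_prolongMap h).mdifferentiableAt (by simp)
  have h1 : HasMFDerivAt 𝓘(ℝ, GrassmannModel n m) 𝓘(ℝ, Model n m) GrassmannBundle.pt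
      (prolongMap φ h.mem_maximalAtlas f P.pt) (mfderiv 𝓘(ℝ, GrassmannModel n m) 𝓘(ℝ, Model n m)
        GrassmannBundle.pt P.jet1 : GrassmannModel n m →L[ℝ] Model n m) := by
    rw [prolongMap_pt h]
    exact (contMDiff_pt.contMDiffAt.mdifferentiableAt (by simp)).hasMFDerivAt
  have h2 := h1.comp P.pt hτ.hasMFDerivAt
  have h3 : HasMFDerivAt 𝓘(ℝ, Model n m) 𝓘(ℝ, Model n m)
      (GrassmannBundle.pt ∘ prolongMap φ h.mem_maximalAtlas f) P.pt (ContinuousLinearMap.id ℝ _) :=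
    (hasMFDerivAt_id P.pt).congr_of_eventuallyEq (eventually_pt_prolongMap h)
  exact congrArg (fun T => T w) (hasMFDerivAt_unique h2 h3)

/-- Since `prolongMap ∘ π_{1,0}` is the identity on `L^{(1)}`, a vector of the `R`-plane is
determined by its projection. This makes the lift in `IsGrassmannianStructure` unambiguous. -/
theorem eq_prolongVector_of_mem_rPlane (h : IsLocalGraph P.carrier P.pt φ f)
    {v : TangentSpace 𝓘(ℝ, GrassmannModel n m) P.jet1} (hv : v ∈ P.rPlane) :
    v = prolongVector h (mfderiv 𝓘(ℝ, GrassmannModel n m) 𝓘(ℝ, Model n m)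
      GrassmannBundle.pt P.jet1 v) := by
  refine (mfderiv_mfderiv_of_mem_tangentPlane
    (contMDiff_pt.contMDiffAt.mdifferentiableAt (by simp))
    ((contMDiffAt_prolongMap h).mdifferentiableAt (by simp)) ?_ hv).symm
  filter_upwards [contMDiff_pt.continuous.continuousAt.eventually h.eventually] with θ hθ hm
  exact prolongMap_eq hθ hm.1 hm.2

/-- The restriction of a section of the tautological bundle to the first prolongation. -/
def restrictField (h : IsLocalGraph P.carrier P.pt φ f)
    (Y : ∀ θ : GrassmannBundle n m E, TangentSpace 𝓘(ℝ, Model n m) θ.pt) (q : E) :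
    TangentSpace 𝓘(ℝ, Model n m) q :=
  show Model n m from Y (prolongMap φ h.mem_maximalAtlas f q)

/-- A tautological section takes values in the plane where it is evaluated, and over a point of `L`
that plane is the tangent space of `L`. -/
theorem isTangentField_restrictField (h : IsLocalGraph P.carrier P.pt φ f)
    {Y : ∀ θ : GrassmannBundle n m E, TangentSpace 𝓘(ℝ, Model n m) θ.pt}
    (hY : IsTautologicalSectionAt Y P.jet1) : P.IsTangentField (restrictField h Y) := by
  constructor
  · have h1 := hY.contMDiffAt
    rw [← prolongMap_pt h] at h1
    refine (h1.comp P.pt (contMDiffAt_prolongMap h)).congr_of_eventuallyEq ?_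
    filter_upwards [eventually_pt_prolongMap h] with q hq
    exact tangentBundle_mk_congr hq.symm rfl
  · filter_upwards [h.eventually] with q hq hqL
    have hpt := pt_prolongMap (f := f) h.mem_maximalAtlas hq.mem_source
    have h1 := hY.mem_plane (prolongMap φ h.mem_maximalAtlas f q)
    rw [plane_prolongMap hq hqL] at h1
    have key : ∀ {q' : E} (_ : q' = q) {v : TangentSpace 𝓘(ℝ, Model n m) q'},
        v ∈ tangentPlane (Model n m) P.carrier q' →
        (show TangentSpace 𝓘(ℝ, Model n m) q from (show Model n m from v)) ∈
          tangentPlane (Model n m) P.carrier q := by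
      rintro _ rfl v hv; exact hv
    exact key hpt h1

/-- The bridge between `Γ̇` and the second fundamental form: along the section `prolongMap` the
pull-back derivative reduces to the covariant derivative of the restricted field. -/
theorem dotVerticalProj_prolongVector (Γ : LinearConnection n m E)
    (h : IsLocalGraph P.carrier P.pt φ f)
    {Y : ∀ θ : GrassmannBundle n m E, TangentSpace 𝓘(ℝ, Model n m) θ.pt}
    (hY : IsTautologicalSectionAt Y P.jet1) (w : tangentPlane (Model n m) P.carrier P.pt) :
    dotVerticalProj Γ P.jet1 (prolongVector h w) Y =
      secondFundamentalForm Γ P w (restrictField h Y) :=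
  congrArg P.jet1.plane.mkQ (pullbackCov_mfderiv Γ (y := P.jet1)
    (hY.contMDiffAt.mdifferentiableAt (by simp))
    ((contMDiffAt_prolongMap h).mdifferentiableAt (by simp)) (prolongMap_pt h)
    (eventually_pt_prolongMap h) (fun _ => rfl) w.1)

/-- The vectors of the `R`-plane of `[L]^2_p` are horizontal lifts if and only if the second
fundamental form of `L` vanishes at `p`. -/
theorem forall_isHorizontalLift_iff (Γ : LinearConnection n m E) (P : PointedSubmanifold n m E) :
    (∀ w ∈ P.jet1.plane, ∃ v ∈ P.rPlane, IsHorizontalLift Γ P.jet1 w v) ↔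
      IsTotallyGeodesicAt Γ P := by
  obtain ⟨φ, f, h⟩ := P.exists_graph P.pt P.pt_mem
  have hφ := h.mem_maximalAtlas
  constructor
  · intro hP
    rw [isTotallyGeodesicAt_iff Γ h]
    intro a b
    have hw : chartFrame φ P.pt (a, fderiv ℝ f (φ P.pt).1 a) ∈
        tangentPlane (Model n m) P.carrier P.pt := by
      rw [mem_tangentPlane_iff P.pt_mem h, dChart_chartFrame hφ h.mem_source]
    obtain ⟨v, hv, hvw, hlift⟩ := hP _ hw
    -- The lift, given only as some vector of the `R`-plane over `w`, must be `prolongVector h w`.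
    have hv' := eq_prolongVector_of_mem_rPlane h hv
    rw [hvw] at hv'
    subst hv'
    have hY := isTautologicalSectionAt_tautField (θ := P.jet1) hφ h.mem_source
      ⟨_, hasSlope_jet1 h⟩ b
    have h1 := (dotVerticalProj_prolongVector Γ h hY ⟨_, hw⟩).symm.trans (hlift _ hY)
    have h2 := (secondFundamentalForm_eq_zero_iff Γ h (isTangentField_restrictField h hY) _).1 h1
    have h3 : dChart φ P.pt (restrictField h (tautField φ b) P.pt) =
        (b, slope φ P.jet1 b) := by
      have h4 : restrictField h (tautField φ b) P.pt =
          chartFrame φ P.pt (b, slope φ P.jet1 b) := by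
        refine (congrArg (fun θ => show Model n m from tautField φ b θ) (prolongMap_pt h)).trans ?_
        exact if_pos ⟨h.mem_source, _, hasSlope_jet1 h⟩
      rw [h4, dChart_chartFrame hφ h.mem_source]
    rw [h3] at h2
    simpa [dChart_chartFrame hφ h.mem_source] using h2
  · intro hP w hw
    refine ⟨prolongVector h w, prolongVector_mem_rPlane h hw, mfderiv_pt_prolongVector h w,
      fun Y hY => ?_⟩
    rw [dotVerticalProj_prolongVector Γ h hY ⟨w, hw⟩]
    exact hP _ _ (isTangentField_restrictField h hY)

end HorizontalLifts

/-! ### A common divided chart, and uniqueness of the 2-jet. -/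

section CommonCharts

variable {n m : ℕ} {E : Type*} [TopologicalSpace E] [ChartedSpace (Model n m) E]
  [IsManifold 𝓘(ℝ, Model n m) ∞ E] {P Q : PointedSubmanifold n m E}

/-- A smooth map `(a, b)` whose first component `a` has an invertible derivative at `u₀`
parametrizes, near `u₀`, the graph of a smooth map: that of `f = b ∘ a⁻¹`. -/
theorem exists_graph_of_parametrization {X Y : Type*} [NormedAddCommGroup X] [NormedSpace ℝ X]
    [CompleteSpace X] [NormedAddCommGroup Y] [NormedSpace ℝ Y] {a : X → X} {b : X → Y} {u₀ : X}
    (ha : ∀ᶠ u in 𝓝 u₀, ContDiffAt ℝ ∞ a u) (hb : ∀ᶠ u in 𝓝 u₀, ContDiffAt ℝ ∞ b u)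
    (hu : IsUnit (fderiv ℝ a u₀)) :
    ∃ (f : X → Y) (e : OpenPartialHomeomorph X X), u₀ ∈ e.source ∧ (e : X → X) = a ∧
      (∀ᶠ x in 𝓝 (a u₀), ContDiffAt ℝ ∞ f x) ∧ ∀ x, f x = b (e.symm x) := by
  have ha0 := ha.self_of_nhds
  have hD : HasFDerivAt a ((ContinuousLinearEquiv.unitsEquiv ℝ X hu.unit : X ≃L[ℝ] X) : X →L[ℝ] X)
      u₀ := (ha0.differentiableAt (by simp)).hasFDerivAt
  let e := ha0.toOpenPartialHomeomorph a hD (by simp)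
  have he : (e : X → X) = a := rfl
  have hsrc : u₀ ∈ e.source := ha0.mem_toOpenPartialHomeomorph_source hD (by simp)
  refine ⟨fun x => b (e.symm x), e, hsrc, he, ?_, fun _ => rfl⟩
  have hcont : ContinuousAt (fderiv ℝ a) u₀ :=
    (ha0.fderiv_right (m := ∞) (by simp)).continuousAt
  -- Smoothness of `f` is required at all points near `a u₀`, so the derivative of `a` has to stay
  -- invertible nearby.
  have hunit : ∀ᶠ u in 𝓝 u₀, IsUnit (fderiv ℝ a u) := hcont.eventually (Units.isOpen.mem_nhds hu)
  have htgt : a u₀ ∈ e.target := e.map_source hsrc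
  have hsymm : Tendsto e.symm (𝓝 (a u₀)) (𝓝 u₀) := by
    have h1 := (e.continuousAt_symm htgt).tendsto
    have h2 : e.symm (a u₀) = u₀ := e.left_inv hsrc
    rwa [h2] at h1
  filter_upwards [e.open_target.mem_nhds htgt, hsymm.eventually hunit, hsymm.eventually ha,
    hsymm.eventually hb] with x h1 h2 h3 h4
  have hDx : HasFDerivAt e ((ContinuousLinearEquiv.unitsEquiv ℝ X h2.unit : X ≃L[ℝ] X) :
      X →L[ℝ] X) (e.symm x) := (h3.differentiableAt (by simp)).hasFDerivAt
  exact h4.comp x (e.contDiffAt_symm h1 hDx h3)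

/-- A submanifold is a graph in every divided chart that is concordant to its tangent plane. -/
theorem exists_isLocalGraph {φ : OpenPartialHomeomorph E (Model n m)}
    (hφ : φ ∈ IsManifold.maximalAtlas 𝓘(ℝ, Model n m) ∞ E) (hp : P.pt ∈ φ.source)
    (hs : ∃ A, HasSlope φ P.jet1 A) : ∃ f, IsLocalGraph P.carrier P.pt φ f := by
  obtain ⟨ψ, g, h⟩ := P.exists_graph P.pt P.pt_mem
  have hψ := h.mem_maximalAtlas
  have hpψ := h.mem_source
  have hg : ContDiffAt ℝ ∞ g (ψ P.pt).1 := h.contDiffAt.self_of_nhds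
  have hpt : (ψ P.pt).2 = g (ψ P.pt).1 := h.mem_iff.self_of_nhds.1 P.pt_mem
  set p := P.pt with hpdef
  set u₀ := (ψ p).1 with hu₀
  let c : EuclideanSpace ℝ (Fin n) → Model n m := fun u => (u, g u)
  have hc0 : c u₀ = ψ p := Prod.ext rfl hpt.symm
  let S := (ψ.symm.trans φ).source
  have hS : IsOpen S := (ψ.symm.trans φ).open_source
  have hmemS {z : Model n m} : z ∈ S ↔ z ∈ ψ.target ∧ ψ.symm z ∈ φ.source := by
    simp only [S, OpenPartialHomeomorph.trans_source]
    exact Iff.rfl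
  have hpS : ψ p ∈ S := hmemS.2 ⟨ψ.map_source hpψ, by rwa [ψ.left_inv hpψ]⟩
  let χ : Model n m → Model n m := φ ∘ ψ.symm
  have hχ {z : Model n m} (hz : z ∈ S) : ContDiffAt ℝ ∞ χ z :=
    (contDiffOn_change hψ hφ).contDiffAt (hS.mem_nhds hz)
  have hcu : ∀ᶠ u in 𝓝 u₀, ContDiffAt ℝ ∞ g u ∧ c u ∈ S := by
    have hcc : ContinuousAt c u₀ := continuousAt_id.prodMk hg.continuousAt
    exact h.contDiffAt.and (hcc.eventually (hc0.symm ▸ hS.mem_nhds hpS))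
  have hχc : ∀ᶠ u in 𝓝 u₀, ContDiffAt ℝ ∞ (fun u => χ (c u)) u := by
    filter_upwards [hcu] with u hu
    exact (hχ hu.2).comp u (contDiffAt_id.prodMk hu.1)
  -- Concordance of `φ` to `T_pL` says precisely that the first component of `χ ∘ c`, which
  -- parametrizes `L` in the chart `φ`, has invertible derivative.
  have hunit : IsUnit (graphFst (changeDeriv ψ φ (ψ p)) (fderiv ℝ g u₀)) := by
    obtain ⟨A, hA⟩ := hs
    rw [← prolongMap_pt h, prolongMap] at hA
    exact (exists_map_graph_iff _ _).1 ⟨A, (map_plane_planeOfSlope hψ hφ hpS A).1 hA⟩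
  have hD : HasFDerivAt (fun u => (χ (c u)).1)
      (graphFst (changeDeriv ψ φ (ψ p)) (fderiv ℝ g u₀)) u₀ := by
    have h1 : HasFDerivAt c (graphEmb (fderiv ℝ g u₀)) u₀ := by
      refine ((hasFDerivAt_id u₀).prodMk
        (hg.differentiableAt (by simp)).hasFDerivAt).congr_fderiv ?_
      ext1 v
      rw [graphEmb_apply]; rfl
    have h2 : HasFDerivAt χ (changeDeriv ψ φ (ψ p)) (c u₀) := by
      rw [hc0]; exact ((hχ hpS).differentiableAt (by simp)).hasFDerivAt
    exact (h2.comp u₀ h1).fst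
  obtain ⟨f, e, he0, hea, hf, hfe⟩ := exists_graph_of_parametrization
    (a := fun u => (χ (c u)).1) (b := fun u => (χ (c u)).2) (u₀ := u₀)
    (hχc.mono fun u hu => hu.fst) (hχc.mono fun u hu => hu.snd) (hD.fderiv ▸ hunit)
  have hx₀ : (χ (c u₀)).1 = (φ p).1 := by rw [hc0]; simp [χ, ψ.left_inv hpψ]
  rw [hx₀] at hf
  refine ⟨f, hφ, hp, hf, ?_⟩
  have htgt : (φ p).1 ∈ e.target := by
    rw [← hx₀, ← congrFun hea u₀]; exact e.map_source he0
  have hsymm : Tendsto (fun q => e.symm (φ q).1) (𝓝 p) (𝓝 u₀) := by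
    have h1 := (e.continuousAt_symm htgt).tendsto
    rw [← hx₀, ← congrFun hea u₀, e.left_inv he0, congrFun hea u₀, hx₀] at h1
    exact h1.comp ((continuous_fst.tendsto _).comp (φ.continuousAt hp))
  have hψ1 : Tendsto (fun q => (ψ q).1) (𝓝 p) (𝓝 u₀) :=
    (continuous_fst.tendsto _).comp (ψ.continuousAt hpψ)
  have hφ1 : Tendsto (fun q => (φ q).1) (𝓝 p) (𝓝 (φ p).1) :=
    (continuous_fst.tendsto _).comp (φ.continuousAt hp)
  filter_upwards [ψ.open_source.mem_nhds hpψ, φ.open_source.mem_nhds hp, h.mem_iff,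
    hψ1.eventually (e.open_source.mem_nhds he0), hφ1.eventually (e.open_target.mem_nhds htgt),
    hsymm.eventually hcu] with q hqψ hqφ hqL hqs hqt hqc
  rw [hqL, hfe]
  constructor
  · intro hq
    have h1 : c (ψ q).1 = ψ q := Prod.ext rfl hq.symm
    have h2 : χ (c (ψ q).1) = φ q := by rw [h1]; simp [χ, ψ.left_inv hqψ]
    have h3 : e (ψ q).1 = (φ q).1 := by rw [congrFun hea]; rw [h2]
    rw [← h3, e.left_inv hqs, h2]
  -- The point of `L` with parameter `e.symm (φ q).1` has the same `φ`-coordinates as `q`, so it is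
  -- `q` by injectivity of `φ`.
  · intro hq
    have h1 : (χ (c (e.symm (φ q).1))).1 = (φ q).1 := by
      rw [← congrFun hea]; exact e.right_inv hqt
    have h2 : φ (ψ.symm (c (e.symm (φ q).1))) = φ q := Prod.ext h1 hq.symm
    have h3 := hmemS.1 hqc.2
    have h4 : ψ.symm (c (e.symm (φ q).1)) = q := φ.injOn h3.2 hqφ h2
    have h5 : c (e.symm (φ q).1) = ψ q := by rw [← h4, ψ.right_inv h3.1]; rw [h4]
    rw [← h5]

/-- Two submanifolds with the same tangent plane and vanishing second fundamental forms have the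
same `2`-jet. -/
theorem jet_two_eq {Γ : LinearConnection n m E} (hP : IsTotallyGeodesicAt Γ P)
    (hQ : IsTotallyGeodesicAt Γ Q) (h : P.jet1 = Q.jet1) : P.jet 2 = Q.jet 2 := by
  have hpt : P.pt = Q.pt := congrArg GrassmannBundle.pt h
  -- Contact is tested in a single chart; one adapted to the common tangent plane presents both
  -- submanifolds as graphs.
  obtain ⟨φ, hφ, hp, hs⟩ := exists_dividedChart P.jet1
  change P.pt ∈ φ.source at hp
  obtain ⟨f, hf⟩ := exists_isLocalGraph hφ hp hs
  obtain ⟨g, hg⟩ := exists_isLocalGraph (P := Q) hφ (hpt ▸ hp) (h ▸ hs)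
  have h1 : fderiv ℝ f (φ P.pt).1 = fderiv ℝ g (φ P.pt).1 := by
    have hg1 := hasSlope_jet1 hg
    rw [← h, ← hpt] at hg1
    rw [← (hasSlope_jet1 hf).slope_eq, ← hg1.slope_eq]
  have h0 : f (φ P.pt).1 = g (φ P.pt).1 := by
    rw [← hf.mem_iff.self_of_nhds.1 P.pt_mem, hpt, ← hg.mem_iff.self_of_nhds.1 Q.pt_mem]
  have h2 : fderiv ℝ (fderiv ℝ f) (φ P.pt).1 = fderiv ℝ (fderiv ℝ g) (φ P.pt).1 := by
    ext1 a
    ext1 b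
    have e1 := (isTotallyGeodesicAt_iff Γ hf).1 hP a b
    have e2 := (isTotallyGeodesicAt_iff Γ hg).1 hQ a b
    rw [← hpt, ← h1] at e2
    -- Both Hessians are minus the `slopeForm` of the same slope.
    exact add_right_cancel (e1.trans e2.symm)
  refine Quot.sound ⟨hpt, φ, f, g, hf, hg, fun k hk => ?_⟩
  interval_cases k
  · ext1 v; simp [h0]
  · ext1 v; simp [iteratedFDeriv_one_apply, h1]
  · ext1 v; simp [iteratedFDeriv_two_apply, h2]

end CommonCharts

/-! ### Existence of a totally geodesic 2-jet over every plane. -/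

section Existence

/-- Take the quadratic Taylor polynomial. Symmetry of `B` merges the two terms of the derivative of
`B (z - x) (z - x)`, and the factor `1 / 2` compensates for the doubling. -/
theorem exists_contDiff_of_two_jet {X Y : Type*} [NormedAddCommGroup X] [NormedSpace ℝ X]
    [NormedAddCommGroup Y] [NormedSpace ℝ Y] (x : X) (y : Y) (A : X →L[ℝ] Y)
    (B : X →L[ℝ] X →L[ℝ] Y) (hB : ∀ a b, B a b = B b a) :
    ∃ f : X → Y, ContDiff ℝ ∞ f ∧ f x = y ∧ fderiv ℝ f x = A ∧ fderiv ℝ (fderiv ℝ f) x = B := by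
  let f : X → Y := fun z => y + A (z - x) + (1 / 2 : ℝ) • B (z - x) (z - x)
  have hs (z : X) : HasFDerivAt (fun z : X => z - x) (ContinuousLinearMap.id ℝ X) z :=
    (hasFDerivAt_id z).sub_const x
  have hf (z : X) : HasFDerivAt f (A + B (z - x)) z := by
    have h1 := (A.hasFDerivAt (x := z - x)).comp z (hs z)
    have h2 := (((B.hasFDerivAt (x := z - x)).comp z (hs z)).clm_apply (hs z)).const_smul
      (1 / 2 : ℝ)
    refine ((h1.const_add y).add h2).congr_fderiv ?_
    ext1 v
    change A v + (1 / 2 : ℝ) • (B (z - x) v + B v (z - x)) = A v + B (z - x) v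
    rw [hB v]
    module
  have hf' : fderiv ℝ f = fun z => A + B (z - x) := funext fun z => (hf z).fderiv
  refine ⟨f, by fun_prop, by simp [f], by simp [hf'], ?_⟩
  rw [hf']
  exact ((HasFDerivAt.comp (g := B) (f := fun z => z - x) x B.hasFDerivAt (hs x)).const_add A).fderiv

variable {n m : ℕ} {E : Type*} [TopologicalSpace E] [ChartedSpace (Model n m) E]
  [IsManifold 𝓘(ℝ, Model n m) ∞ E]

/-- Here torsion-freeness enters existence: the form must be symmetric to be minus a Hessian. -/
theorem slopeForm_symm (Γ : LinearConnection n m E) (hΓ : Γ.torsion = 0)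
    {φ : OpenPartialHomeomorph E (Model n m)}
    (hφ : φ ∈ IsManifold.maximalAtlas 𝓘(ℝ, Model n m) ∞ E) {p : E} (hp : p ∈ φ.source)
    (A : EuclideanSpace ℝ (Fin n) →L[ℝ] EuclideanSpace ℝ (Fin m)) (a b : EuclideanSpace ℝ (Fin n)) :
    slopeForm Γ φ p A a b = slopeForm Γ φ p A b a := by
  rw [slopeForm, slopeForm, christoffel_symm Γ hΓ hφ hp]

theorem slopeForm_add_left (Γ : LinearConnection n m E) (φ : OpenPartialHomeomorph E (Model n m))
    (p : E) (A : EuclideanSpace ℝ (Fin n) →L[ℝ] EuclideanSpace ℝ (Fin m))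
    (a a' b : EuclideanSpace ℝ (Fin n)) :
    slopeForm Γ φ p A (a + a') b = slopeForm Γ φ p A a b + slopeForm Γ φ p A a' b := by
  have h : ((a + a', A (a + a')) : Model n m) = (a, A a) + (a', A a') := by simp
  simp only [slopeForm]
  rw [h, christoffel_add_left, Prod.snd_add, Prod.fst_add, map_add]
  abel

theorem slopeForm_smul_left (Γ : LinearConnection n m E) (φ : OpenPartialHomeomorph E (Model n m))
    (p : E) (A : EuclideanSpace ℝ (Fin n) →L[ℝ] EuclideanSpace ℝ (Fin m))
    (r : ℝ) (a b : EuclideanSpace ℝ (Fin n)) :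
    slopeForm Γ φ p A (r • a) b = r • slopeForm Γ φ p A a b := by
  have h : ((r • a, A (r • a)) : Model n m) = r • (a, A a) := by simp
  simp only [slopeForm]
  rw [h, christoffel_smul_left, Prod.smul_snd, Prod.smul_fst, map_smul, smul_sub]

/-- Every plane is tangent to a submanifold with vanishing second fundamental form there. -/
theorem exists_isTotallyGeodesicAt (Γ : LinearConnection n m E) (hΓ : Γ.torsion = 0)
    (θ : GrassmannBundle n m E) : ∃ P, P.jet1 = θ ∧ IsTotallyGeodesicAt Γ P := by
  obtain ⟨φ, hφ, hp, A, hA⟩ := exists_dividedChart θ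
  have hsymm := slopeForm_symm Γ hΓ hφ hp A
  let B : EuclideanSpace ℝ (Fin n) →L[ℝ] EuclideanSpace ℝ (Fin n) →L[ℝ] EuclideanSpace ℝ (Fin m) :=
    (LinearMap.mk₂ ℝ (slopeForm Γ φ θ.pt A) (slopeForm_add_left Γ φ θ.pt A)
      (slopeForm_smul_left Γ φ θ.pt A)
      -- Linearity in the second argument is obtained from the first by symmetry.
      (fun a b b' => by
        rw [hsymm, slopeForm_add_left, hsymm b, hsymm b'])
      (fun r a b => by rw [hsymm, slopeForm_smul_left, hsymm b])).toContinuousBilinearMap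
  have hB (a b : EuclideanSpace ℝ (Fin n)) : B a b = slopeForm Γ φ θ.pt A a b := rfl
  -- The Hessian `-B` is the one imposed by `isTotallyGeodesicAt_iff`.
  obtain ⟨f, hf, hf0, hf1, hf2⟩ := exists_contDiff_of_two_jet (φ θ.pt).1 (φ θ.pt).2 A (-B)
    (fun a b => by simp only [neg_apply, hB]; rw [hsymm])
  let P := graphSubmanifold φ hφ f hf θ.pt hp hf0.symm
  have hloc : IsLocalGraph P.carrier P.pt φ f := isLocalGraph_graphSubmanifold
  refine ⟨P, ?_, ?_⟩
  · have h1 := hasSlope_jet1 hloc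
    change HasSlope φ P.jet1 (fderiv ℝ f (φ θ.pt).1) at h1
    rw [hf1] at h1
    exact GrassmannBundle.eq_of_hasSlope hφ hp rfl h1 hA
  · rw [isTotallyGeodesicAt_iff Γ hloc]
    intro a b
    change fderiv ℝ (fderiv ℝ f) (φ θ.pt).1 a b + slopeForm Γ φ θ.pt (fderiv ℝ f (φ θ.pt).1) a b = 0
    rw [hf2, hf1, neg_apply, neg_apply, hB, neg_add_cancel]

end Existence

/-! ### Grassmannian structures as sections of the equation. -/

section GrassmannianStructure

variable {n m : ℕ} {E : Type*} [TopologicalSpace E] [ChartedSpace (Model n m) E]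
  [IsManifold 𝓘(ℝ, Model n m) ∞ E]

/-- The `n`-Grassmannian structures are the sections of `π_{2,1}` with values in the equation of
totally geodesic submanifolds. -/
theorem isGrassmannianStructure_iff (Γ : LinearConnection n m E)
    (s : GrassmannBundle n m E → Jet n m E 2) : IsGrassmannianStructure Γ s ↔
      ∀ θ, jetProj (s θ) = θ ∧ s θ ∈ totallyGeodesicEquation Γ := by
  -- Both sides ask for some representative `P` of the jet, and the same `P` serves for both, so
  -- independence of the representative is not needed.
  refine forall_congr' fun θ => and_congr_right fun _ => exists_congr fun P =>
    and_congr_right fun _ => ?_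
  exact forall_isHorizontalLift_iff Γ P

/-- The equation meets each fibre of `π_{2,1}` at most once. This gives the uniqueness of the
section and also lets the section be recovered from its image. -/
theorem eq_of_mem_totallyGeodesicEquation {Γ : LinearConnection n m E} {j j' : Jet n m E 2}
    (hj : j ∈ totallyGeodesicEquation Γ) (hj' : j' ∈ totallyGeodesicEquation Γ)
    (h : jetProj j = jetProj j') : j = j' := by
  obtain ⟨P, rfl, hP⟩ := hj
  obtain ⟨Q, rfl, hQ⟩ := hj'
  exact jet_two_eq hP hQ h

theorem existsUnique_isGrassmannianStructure (Γ : LinearConnection n m E) (hΓ : Γ.torsion = 0) :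
    ∃! s, IsGrassmannianStructure Γ s := by
  choose P hP1 hP2 using exists_isTotallyGeodesicAt Γ hΓ
  have hs : IsGrassmannianStructure Γ fun θ => (P θ).jet 2 :=
    (isGrassmannianStructure_iff Γ _).2 fun θ => ⟨hP1 θ, P θ, rfl, hP2 θ⟩
  refine ⟨_, hs, fun s' hs' => funext fun θ => ?_⟩
  rw [isGrassmannianStructure_iff] at hs hs'
  exact eq_of_mem_totallyGeodesicEquation (hs' θ).2 (hs θ).2 ((hs' θ).1.trans (hs θ).1.symm)

/-- The equation of totally geodesic submanifolds is the image of the `n`-Grassmannian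
structure. -/
theorem IsGrassmannianStructure.range_eq {Γ : LinearConnection n m E}
    {s : GrassmannBundle n m E → Jet n m E 2} (hs : IsGrassmannianStructure Γ s) :
    totallyGeodesicEquation Γ = range s := by
  rw [isGrassmannianStructure_iff] at hs
  refine Subset.antisymm (fun j hj => ⟨jetProj j, ?_⟩) (range_subset_iff.2 fun θ => (hs θ).2)
  exact eq_of_mem_totallyGeodesicEquation (hs _).2 hj (hs _).1

theorem isGrassmannianEquivalent_iff {Γ Γ' : LinearConnection n m E}
    {s s' : GrassmannBundle n m E → Jet n m E 2} (hs : IsGrassmannianStructure Γ s)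
    (hs' : IsGrassmannianStructure Γ' s') : IsGrassmannianEquivalent Γ Γ' ↔ s = s' := by
  constructor
  · intro h
    rw [isGrassmannianStructure_iff] at hs hs'
    refine funext fun θ => eq_of_mem_totallyGeodesicEquation (hs θ).2 ?_
      ((hs θ).1.trans (hs' θ).1.symm)
    rw [show totallyGeodesicEquation Γ = totallyGeodesicEquation Γ' from h]
    exact (hs' θ).2
  · rintro rfl
    exact hs.range_eq.trans hs'.range_eq.symm

end GrassmannianStructure

end
end SubmanifoldJet

theorem mainTheorem3 (n m : ℕ) (E : Type*) [TopologicalSpace E] [T2Space E]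
    [SecondCountableTopology E] [ChartedSpace (SubmanifoldJet.Model n m) E]
    [IsManifold 𝓘(ℝ, SubmanifoldJet.Model n m) ∞ E]
    (Γ Γ' : SubmanifoldJet.LinearConnection n m E)
    (hΓsmooth : CovariantDerivative.ContMDiffCovariantDerivative Γ ∞)
    (hΓ'smooth : CovariantDerivative.ContMDiffCovariantDerivative Γ' ∞)
    (hΓ : Γ.torsion = 0) (hΓ' : Γ'.torsion = 0) :
    (∃! s, SubmanifoldJet.IsGrassmannianStructure Γ s) ∧
    (∃! s', SubmanifoldJet.IsGrassmannianStructure Γ' s') ∧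
    ∀ s s' : SubmanifoldJet.GrassmannBundle n m E → SubmanifoldJet.Jet n m E 2,
      SubmanifoldJet.IsGrassmannianStructure Γ s →
      SubmanifoldJet.IsGrassmannianStructure Γ' s' →
      (SubmanifoldJet.IsGrassmannianEquivalent Γ Γ' ↔ s = s') :=
    ⟨SubmanifoldJet.existsUnique_isGrassmannianStructure Γ hΓ,
      SubmanifoldJet.existsUnique_isGrassmannianStructure Γ' hΓ',
      fun _ _ hs hs' => SubmanifoldJet.isGrassmannianEquivalent_iff hs hs'⟩
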